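/- Let $R$ be a commutative ring with identity and let $C$ be a semidualizing $R$-module, i.e. $C$ has a resolution by finitely generated projective $R$-modules, the homothety map $R\to \mathrm{Hom}_R(C,C)$ is an isomorphism, and $\mathrm{Ext}_R^i(C,C)=0$ for all $i\ge 1$. A module is called $C$-projective (resp. $C$-flat) if it is isomorphic to $C\otimes_R P$ with $P$ projective (resp. $C\otimes_R F$ with $F$ flat). Let $\mathrm{Ch}(R)$ be the category of ($\mathbb{Z}$-indexed, unbounded) complexes of $R$-modules. A complex is called projective (resp. $C$-projective, $C$-flat) if it is exact and all its cycle modules are projective (resp. $C$-projective, $C$-flat) modules. A complex $X$ is called $D_C$-projective if there is an exact sequence in $\mathrm{Ch}(R)$ $$\cdots\to P_1\to P_0\xrightarrow{f_0} Q_{-1}\to Q_{-2}\to\cdots$$ with all $P_i$ projective complexes and all $Q_i$ $C$-projective complexes, which stays exact under $\mathrm{Hom}_{\mathrm{Ch}(R)}(-,H)$ for every $C$-flat complex $H$, and such that $X\cong \mathrm{Im} f_0$. The $D_C$-projective dimension $D_C\text{-pd}(X)$ of a complex $X$ is the least integer $n\ge 0$ for which there is an exact sequence $0\to G_n\to\cdots\to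 G_0\to X\to 0$ in $\mathrm{Ch}(R)$ with all $G_i$ $D_C$-projective, and $\infty$ if there is no such $n$; the $\mathcal{F}_C$-dimension $\mathcal{F}_C\text{-pd}(X)$ is defined in the same way with all $G_i$ $C$-flat complexes. $\mathrm{Ext}^m$ of complexes is taken in the abelian category $\mathrm{Ch}(R)$. **Theorem 3.3.** Let $X\in\mathrm{Ch}(R)$ and let $n\ge 0$ be an integer. The following are equivalent: 1. $D_C\text{-pd}(X)\le n$. 2. $D_C\text{-pd}(X)<\infty$ and $\mathrm{Ext}^m(X,H)=0$ for all $m>n$ and all $H\in\mathrm{Ch}(R)$ with $\mathcal{F}_C\text{-pd}(H)<\infty$. 3. $D_C\text{-pd}(X)<\infty$ and $\mathrm{Ext}^m(X,H)=0$ for all $m>n$ and all $C$-flat complexes $H$. 4. For every exact sequence $\cdots\to G_n\to G_{n-1}\to\cdots\to G_0\to X\to 0$ in $\mathrm{Ch}(R)$ with all $G_i$ $D_C$-projective, the kernel $K_n=\mathrm{Ker}(G_{n-1}\to G_{n-2})$ is $D_C$-projective (where $G_{-1}=X$ and $G_{-2}=0$, so that $K_0=X$). 5. For every integer $t$ with $0\le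 t\le n$ there is an exact sequence $$0\to Q_n\to\cdots\to Q_{t+1}\to G_t\to P_{t-1}\to\cdots\to P_0\to X\to 0$$ in $\mathrm{Ch}(R)$ with $G_t$ $D_C$-projective, $Q_i$ a $C$-projective complex for all $i>t$, and $P_i$ a projective complex for all $i<t$. -/

import Mathlib

open CategoryTheory

universe u

namespace DCProj

section Abelian

variable {A : Type*} [Category A] [Abelian A]

/-- A (possibly infinite) exact sequence `⋯ ⟶ G 2 ⟶ G 1 ⟶ G 0 ⟶ X ⟶ 0` in an abelian category:
the terms `G i` with their maps form the chain complex `G`, and `ε` is the last map. -/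
structure ExactResolution (X : A) where
  G : ChainComplex A ℕ
  ε : G.X 0 ⟶ X
  w : G.d 1 0 ≫ ε = 0
  epi_ε : Epi ε
  exact_zero : (ShortComplex.mk (G.d 1 0) ε w).Exact
  exact_succ : ∀ i : ℕ, G.ExactAt (i + 1)

/-- The `n`-th kernel `K_n = Ker (G_{n-1} ⟶ G_{n-2})` of an exact sequence
`⋯ ⟶ G 1 ⟶ G 0 ⟶ X ⟶ 0`, where `G_{-1} = X` and `G_{-2} = 0`; so `K_0 = X`. -/
noncomputable def ExactResolution.kernelObj {X : A} (E : ExactResolution X) : ℕ → A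
  | 0 => X
  | 1 => Limits.kernel E.ε
  | n + 2 => Limits.kernel (E.G.d (n + 1) n)

/-- There is an exact sequence `0 ⟶ G n ⟶ ⋯ ⟶ G 0 ⟶ X ⟶ 0` with all `G i` in the class `P`. -/
def HasResolutionOfLength (P : ObjectProperty A) (X : A) (n : ℕ) : Prop :=
  ∃ E : ExactResolution X, (∀ i ≤ n, P (E.G.X i)) ∧ ∀ i > n, Limits.IsZero (E.G.X i)

/-- The dimension of `X` relative to the class `P`: the least `n` such that there is an exact
sequence `0 ⟶ G n ⟶ ⋯ ⟶ G 0 ⟶ X ⟶ 0` with all `G i` in `P`, and `∞` if there is none. -/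
noncomputable def resDim (P : ObjectProperty A) (X : A) : ℕ∞ :=
  ⨅ (n : ℕ) (_ : HasResolutionOfLength P X n), (n : ℕ∞)

/-- The sequence `Hom(E, H)` of abelian groups is exact for every `H` in the class `B`. -/
def IsHomExact (E : ChainComplex A ℤ) (B : ObjectProperty A) : Prop :=
  ∀ H : A, B H → ∀ (i : ℤ) (g : E.X i ⟶ H), E.d (i + 1) i ≫ g = 0 →
    ∃ h : E.X (i - 1) ⟶ H, E.d i (i - 1) ≫ h = g

end Abelian

variable {R : Type u} [CommRing R]

/-- `C` is a semidualizing `R`-module. -/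
structure IsSemidualizing (C : ModuleCat.{u} R) : Prop where
  /-- `C` has a resolution by finitely generated projective modules. -/
  resolution : ∃ P : ProjectiveResolution C, ∀ n : ℕ, Module.Finite R (P.complex.X n)
  /-- The homothety map `R ⟶ Hom_R(C, C)` is an isomorphism. -/
  homothety : Function.Bijective (LinearMap.lsmul R C)
  ext_eq_zero : ∀ i : ℕ, 1 ≤ i → Subsingleton (Abelian.Ext.{u} C C i)

/-- The class of projective `R`-modules. -/
def projMod (R : Type u) [CommRing R] : ObjectProperty (ModuleCat.{u} R) :=
  fun M => Module.Projective R M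

/-- The class of `C`-projective modules, i.e. those isomorphic to `C ⊗ P` with `P` projective. -/
def cProjMod (C : ModuleCat.{u} R) : ObjectProperty (ModuleCat.{u} R) :=
  fun M => ∃ P : ModuleCat.{u} R, Module.Projective R P ∧ Nonempty (M ≃ₗ[R] TensorProduct R C P)

/-- The class of `C`-flat modules, i.e. those isomorphic to `C ⊗ F` with `F` flat. -/
def cFlatMod (C : ModuleCat.{u} R) : ObjectProperty (ModuleCat.{u} R) :=
  fun M => ∃ F : ModuleCat.{u} R, Module.Flat R F ∧ Nonempty (M ≃ₗ[R] TensorProduct R C F)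

/-- The category `Ch(R)` of unbounded complexes of `R`-modules, with differentials `X i ⟶ X (i-1)`. -/
abbrev Ch (R : Type u) [CommRing R] : Type (u + 1) := ChainComplex (ModuleCat.{u} R) ℤ

/-- The class of exact complexes all of whose cycle modules lie in the class `P` of modules. -/
def tilde (P : ObjectProperty (ModuleCat.{u} R)) : ObjectProperty (Ch R) :=
  fun X => X.Acyclic ∧ ∀ i : ℤ, P (X.cycles i)

/-- The class of projective complexes. -/
def projCx (R : Type u) [CommRing R] : ObjectProperty (Ch R) := tilde (projMod R)

/-- The class of `C`-projective complexes. -/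
def cProjCx (C : ModuleCat.{u} R) : ObjectProperty (Ch R) := tilde (cProjMod C)

/-- The class of `C`-flat complexes. -/
def cFlatCx (C : ModuleCat.{u} R) : ObjectProperty (Ch R) := tilde (cFlatMod C)

/-- The class of `D_C`-projective complexes: `X` is isomorphic to the image of `E 0 ⟶ E (-1)` for
an exact sequence of complexes `E` that stays exact under `Hom(-, H)` for all `C`-flat complexes
`H`, with projective complexes in degrees `≥ 0` and `C`-projective complexes in degrees `< 0`. -/
def dcProjCx (C : ModuleCat.{u} R) : ObjectProperty (Ch R) :=
  fun X => ∃ E : ChainComplex (Ch R) ℤ,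
    E.Acyclic ∧ IsHomExact E (cFlatCx C) ∧
    (∀ i : ℤ, 0 ≤ i → projCx R (E.X i)) ∧
    (∀ i : ℤ, i < 0 → cProjCx C (E.X i)) ∧
    Nonempty (X ≅ Limits.image (E.d 0 (-1)))

/-- The `D_C`-projective dimension of a complex. -/
noncomputable def dcPd (C : ModuleCat.{u} R) (X : Ch R) : ℕ∞ := resDim (dcProjCx C) X

/-- The `F_C`-dimension of a complex, defined by resolutions by `C`-flat complexes. -/
noncomputable def fcPd (C : ModuleCat.{u} R) (X : Ch R) : ℕ∞ := resDim (cFlatCx C) X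

end DCProj

/-! Most of the argument is relative homological algebra, valid in any abelian category for classes
`𝒜` (projectives) and `𝒬 ⊆ ℋ` satisfying `IsAdmissible`. The pivot is `totalProj_of_coresolving`:
membership in `totalProj` follows from membership in some class inside `extPerp ℋ` whose objects
embed into `𝒬` with cokernel in the class. The left half of the complex can then be any
`𝒜`-resolution, and Hom-exactness is just vanishing of Ext¹ on the syzygies. Conversely, `totalProj`
is itself such a class (`extPerp_of_totalProj`, `exists_ses_of_totalProj`). Hence it is closed under
extensions and kernels of epimorphisms, and it contains every object of finite dimension in `extPerp
ℋ` (`totalProj_of_hasResolution`). Dimension shifting then gives the conditions on Ext and kernels,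
and Auslander–Buchweitz approximations (`exists_approximation`) give the mixed resolutions.

The remaining inputs concern complexes over a semidualizing `C`. Vanishing of Ext¹ between cycles
makes projective and `C`-projective complexes sums of disks, and Ext out of a sum of disks is
controlled degreewise (`subsingleton_ext_disk`), so only modules matter. There Ext of positive
degree from `C ⊗ P` to `C ⊗ F` vanishes because `C` has a degreewise finite projective resolution
(`IsSemidualizing.noExt`).

Finally, projective complexes are D_C-projective (`totalProj_of_projCx`): a projective module `M` is
`Hom(C, C) ⊗ M`, and dualizing the resolution of `C` into `C` gives a coresolution of `M` by
`C`-projectives with cosyzygies `Hom(Z, C) ⊗ M`, `Z` a syzygy of `C`. `IsDualizable` collects the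
properties of `C` that pass to its syzygies and make this work. -/

namespace DCProj

open Limits

universe w v₁ u₁

/-! ### Short exact sequences in an abelian category, their pushouts and pullbacks. -/

section SES

variable {A : Type u₁} [Category.{v₁} A] [Abelian A]

/-- The sequence `0 ⟶ X ⟶ Y ⟶ Z ⟶ 0` is exact. -/
def SES {X Y Z : A} (f : X ⟶ Y) (g : Y ⟶ Z) : Prop :=
  ∃ w : f ≫ g = 0, (ShortComplex.mk f g w).ShortExact

namespace SES

variable {X Y Z : A} {f : X ⟶ Y} {g : Y ⟶ Z}

lemma zero (h : SES f g) : f ≫ g = 0 := h.1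

lemma mono (h : SES f g) : Mono f := h.2.mono_f

lemma epi (h : SES f g) : Epi g := h.2.epi_g

lemma op (h : SES f g) : SES g.op f.op :=
  ⟨by rw [← op_comp, h.zero, op_zero], h.2.op⟩

lemma unop {X Y Z : Aᵒᵖ} {f : X ⟶ Y} {g : Y ⟶ Z} (h : SES f g) : SES g.unop f.unop :=
  ⟨by rw [← unop_comp, h.zero, unop_zero], h.2.unop⟩

lemma exists_desc (h : SES f g) {W : A} (k : Y ⟶ W) (hk : f ≫ k = 0) : ∃ l : Z ⟶ W, g ≫ l = k :=
  have := h.epi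
  ⟨h.2.exact.desc k hk, h.2.exact.g_desc k hk⟩

lemma exists_lift (h : SES f g) {W : A} (k : W ⟶ Y) (hk : k ≫ g = 0) : ∃ l : W ⟶ X, l ≫ f = k :=
  have := h.mono
  ⟨h.2.exact.lift k hk, h.2.exact.lift_f k hk⟩

lemma of_desc [Mono f] [Epi g] (w : f ≫ g = 0)
    (H : ∀ {W : A} (k : Y ⟶ W), f ≫ k = 0 → ∃ l : Z ⟶ W, g ≫ l = k) : SES f g :=
  ⟨w, ShortComplex.ShortExact.mk (ShortComplex.exact_of_g_is_cokernel _
    (CokernelCofork.IsColimit.ofπ' _ _ fun k hk => ⟨(H k hk).choose, (H k hk).choose_spec⟩))⟩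

lemma of_mono (f : X ⟶ Y) [Mono f] : SES f (cokernel.π f) :=
  of_desc (cokernel.condition f) fun k hk => ⟨cokernel.desc f k hk, cokernel.π_desc _ _ _⟩

lemma of_epi (g : Y ⟶ Z) [Epi g] : SES (kernel.ι g) g :=
  ⟨kernel.condition g, ShortComplex.ShortExact.mk
    (ShortComplex.exact_of_f_is_kernel _ (kernelIsKernel g))⟩

lemma id_zero (X : A) {Z : A} (hZ : IsZero Z) : SES (𝟙 X) (0 : X ⟶ Z) :=
  have : Epi (0 : X ⟶ Z) := ⟨fun _ _ _ => hZ.eq_of_src _ _⟩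
  of_desc comp_zero fun k hk => ⟨0, by simpa using hk.symm⟩

lemma zero_id (X : A) {Z : A} (hZ : IsZero Z) : SES (0 : Z ⟶ X) (𝟙 X) :=
  have : Mono (0 : Z ⟶ X) := ⟨fun _ _ _ => hZ.eq_of_tgt _ _⟩
  of_desc zero_comp fun k _ => ⟨k, by simp⟩

lemma isIso_of_isZero_left (h : SES f g) (hX : IsZero X) : IsIso g :=
  h.2.isIso_g_iff.2 hX

lemma biprod (X Z : A) : SES (biprod.inl : X ⟶ X ⊞ Z) biprod.snd :=
  of_desc (by simp) fun k hk => ⟨biprod.inr ≫ k, by ext <;> simp [hk]⟩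

lemma biprod_inr_fst (X Z : A) : SES (biprod.inr : Z ⟶ X ⊞ Z) biprod.fst :=
  of_desc (by simp) fun k hk => ⟨biprod.inl ≫ k, by ext <;> simp [hk]⟩

lemma congr_left (h : SES f g) {X' : A} (e : X' ≅ X) : SES (e.hom ≫ f) g := by
  have := h.mono
  have := h.epi
  exact of_desc (by simp [h.zero]) fun k hk => h.exists_desc k
    (by rw [← cancel_epi e.hom]; simpa using hk)

lemma congr_right (h : SES f g) {Z' : A} (e : Z ≅ Z') : SES f (g ≫ e.hom) := by
  have := h.mono
  have := h.epi
  refine of_desc (by simp [reassoc_of% h.zero]) fun k hk => ?_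
  obtain ⟨l, rfl⟩ := h.exists_desc k hk
  exact ⟨e.inv ≫ l, by simp⟩

lemma pushout_inr (h : SES f g) {X' P : A} {i : X ⟶ X'} {inl : Y ⟶ P} {inr : X' ⟶ P}
    (sq : IsPushout f i inl inr) : ∃ b : P ⟶ Z, SES inr b := by
  have := h.mono
  have := h.epi
  have : Mono inr :=
    (MorphismProperty.monomorphisms A).of_isPushout sq.flip ‹Mono f›
  let b : P ⟶ Z := sq.desc g 0 (by simp [h.zero])
  have : Epi b := epi_of_epi_fac (sq.inl_desc g 0 (by simp [h.zero]))
  refine ⟨b, of_desc (by simp [b]) fun k hk => ?_⟩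
  obtain ⟨l, hl⟩ := h.exists_desc (inl ≫ k) (by rw [sq.w_assoc, hk, comp_zero])
  exact ⟨l, sq.hom_ext (by simpa [b] using hl) (by simp [b, hk])⟩

/-- The pushout of a short exact sequence along a monomorphism. -/
lemma pushout_mono (h : SES f g) {X' X'' : A} {i : X ⟶ X'} {j : X' ⟶ X''} (h' : SES i j) :
    ∃ (P : A) (inl : Y ⟶ P) (inr : X' ⟶ P) (b : P ⟶ Z) (c : P ⟶ X''), SES inr b ∧ SES inl c := by
  have sq := IsPushout.of_hasPushout f i
  obtain ⟨b, hb⟩ := h.pushout_inr sq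
  obtain ⟨c, hc⟩ := h'.pushout_inr sq.flip
  exact ⟨_, _, _, b, c, hb, hc⟩

/-- The pushout of a short exact sequence along an epimorphism. -/
lemma pushout_epi (h : SES f g) {K X' : A} {k : K ⟶ X} {i : X ⟶ X'} (h' : SES k i) :
    ∃ (P : A) (inl : Y ⟶ P) (inr : X' ⟶ P) (b : P ⟶ Z), SES inr b ∧ SES (k ≫ f) inl := by
  have sq := IsPushout.of_hasPushout f i
  obtain ⟨b, hb⟩ := h.pushout_inr sq
  have := h.mono
  have := h'.mono
  have := h'.epi
  have : Epi (pushout.inl f i) := (MorphismProperty.epimorphisms A).of_isPushout sq ‹Epi i›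
  refine ⟨_, _, _, b, hb, of_desc (by rw [Category.assoc, sq.w, reassoc_of% h'.zero, zero_comp])
    fun m hm => ?_⟩
  obtain ⟨l, hl⟩ := h'.exists_desc (f ≫ m) (by simpa using hm)
  exact ⟨sq.desc m l hl.symm, sq.inl_desc _ _ _⟩

/-- The pullback of a short exact sequence along an epimorphism. -/
lemma pullback_epi (h : SES f g) {Z' Z'' : A} {i : Z' ⟶ Z} {j : Z'' ⟶ Z'} (h' : SES j i) :
    ∃ (P : A) (fst : P ⟶ Y) (snd : P ⟶ Z') (b : X ⟶ P) (c : Z'' ⟶ P), SES b snd ∧ SES c fst := by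
  obtain ⟨P, inl, inr, b, c, h₁, h₂⟩ := h.op.pushout_mono h'.op
  exact ⟨_, _, _, _, _, h₁.unop, h₂.unop⟩

/-- The pullback of a short exact sequence along a monomorphism. -/
lemma pullback_mono (h : SES f g) {K Z' : A} {k : Z ⟶ K} {i : Z' ⟶ Z} (h' : SES i k) :
    ∃ (P : A) (fst : P ⟶ Y) (snd : P ⟶ Z') (b : X ⟶ P), SES b snd ∧ SES fst (g ≫ k) := by
  obtain ⟨P, inl, inr, b, h₁, h₂⟩ := h.op.pushout_epi h'.op
  exact ⟨_, _, _, _, h₁.unop, h₂.unop⟩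

lemma nonempty_iso_biprod_of_retraction (h : SES f g) (r : Y ⟶ X) (hr : f ≫ r = 𝟙 X) :
    Nonempty (Y ≅ X ⊞ Z) :=
  have := h.epi
  ⟨(ShortComplex.Splitting.ofExactOfRetraction _ h.2.exact r hr h.epi).isoBinaryBiproduct⟩

lemma nonempty_iso_biprod_of_section (h : SES f g) (s : Z ⟶ Y) (hs : s ≫ g = 𝟙 Z) :
    Nonempty (Y ≅ X ⊞ Z) :=
  ⟨(ShortComplex.Splitting.ofExactOfSection _ h.2.exact s hs h.mono).isoBinaryBiproduct⟩

/-- A product of a short exact sequence with an identity. -/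
lemma biprod_left (h : SES f g) (W : A) :
    SES (f ≫ (biprod.inr : Y ⟶ W ⊞ Y)) (biprod.map (𝟙 W) g) := by
  have := h.mono
  have := h.epi
  refine of_desc (by simp [reassoc_of% h.zero]) fun k hk => ?_
  obtain ⟨l, hl⟩ := h.exists_desc (biprod.inr ≫ k) (by simpa using hk)
  exact ⟨biprod.desc (biprod.inl ≫ k) l, by ext <;> simp [hl]⟩

lemma biprod_left' (h : SES f g) (W : A) :
    SES (biprod.map (𝟙 W) f) ((biprod.snd : W ⊞ Y ⟶ Y) ≫ g) := by
  have := h.mono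
  have := h.epi
  refine of_desc (by simp [h.zero]) fun k hk => ?_
  obtain ⟨l, hl⟩ := h.exists_desc (biprod.inr ≫ k) (by simpa using biprod.inr ≫= hk)
  exact ⟨l, by ext <;> simp [hl]; simpa using (biprod.inl ≫= hk).symm⟩

end SES

end SES

/-! ### Vanishing of Ext along short exact sequences. -/

section Ext

variable {A : Type u₁} [Category.{v₁} A] [Abelian A] [HasExt.{w} A]

open Abelian

namespace SES

variable {X Y Z : A} {f : X ⟶ Y} {g : Y ⟶ Z}

lemma exists_extension (h : SES f g) {H : A} (hH : Subsingleton (Ext.{w} Z H 1)) (k : X ⟶ H) :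
    ∃ l : Y ⟶ H, f ≫ l = k := by
  obtain ⟨x, hx⟩ := Ext.contravariant_sequence_exact₁ h.2 H (Ext.mk₀ k) (add_zero 1)
    (Subsingleton.elim _ _)
  obtain ⟨l, rfl⟩ := Ext.addEquiv₀.symm.surjective x
  exact ⟨l, (Ext.mk₀_bijective _ _).1 (by simpa using hx)⟩

/-- As `Ext¹(Y, H) = 0`, the connecting map from `Hom(X, H)` is onto, and it kills every map that
extends to `Y`. -/
lemma subsingleton_ext_one (h : SES f g) {H : A} (hH : Subsingleton (Ext.{w} Y H 1))
    (hk : ∀ k : X ⟶ H, ∃ l : Y ⟶ H, f ≫ l = k) : Subsingleton (Ext.{w} Z H 1) := by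
  refine subsingleton_of_forall_eq 0 fun x => ?_
  obtain ⟨y, rfl⟩ := Ext.contravariant_sequence_exact₃ h.2 H x (Subsingleton.elim _ _) (add_zero 1)
  obtain ⟨k, rfl⟩ := Ext.addEquiv₀.symm.surjective y
  obtain ⟨l, rfl⟩ := hk k
  have : Ext.addEquiv₀.symm (f ≫ l) = (Ext.mk₀ f).comp (Ext.mk₀ l) (zero_add 0) := by simp
  rw [this]
  exact h.2.extClass_comp_assoc _

lemma subsingleton_ext_right (h : SES f g) {H : A} {m : ℕ} (hX : Subsingleton (Ext.{w} X H m))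
    (hY : Subsingleton (Ext.{w} Y H (m + 1))) : Subsingleton (Ext.{w} Z H (m + 1)) := by
  refine subsingleton_of_forall_eq 0 fun x => ?_
  obtain ⟨y, rfl⟩ := Ext.contravariant_sequence_exact₃ h.2 H x (Subsingleton.elim _ _)
    (add_comm 1 m)
  rw [Subsingleton.elim y 0, Ext.comp_zero]

lemma subsingleton_ext_mid (h : SES f g) {H : A} {m : ℕ} (hX : Subsingleton (Ext.{w} X H m))
    (hZ : Subsingleton (Ext.{w} Z H m)) : Subsingleton (Ext.{w} Y H m) := by
  refine subsingleton_of_forall_eq 0 fun x => ?_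
  obtain ⟨y, rfl⟩ := Ext.contravariant_sequence_exact₂ h.2 H x (Subsingleton.elim _ _)
  rw [Subsingleton.elim y 0, Ext.comp_zero]

lemma subsingleton_ext_left (h : SES f g) {H : A} {m : ℕ} (hY : Subsingleton (Ext.{w} Y H m))
    (hZ : Subsingleton (Ext.{w} Z H (m + 1))) : Subsingleton (Ext.{w} X H m) := by
  refine subsingleton_of_forall_eq 0 fun x => ?_
  obtain ⟨y, rfl⟩ := Ext.contravariant_sequence_exact₁ h.2 H x (add_comm 1 m)
    (Subsingleton.elim _ _)
  rw [Subsingleton.elim y 0, Ext.comp_zero]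

lemma subsingleton_ext_covariant_right (h : SES f g) {U : A} {m : ℕ}
    (hY : Subsingleton (Ext.{w} U Y m)) (hX : Subsingleton (Ext.{w} U X (m + 1))) :
    Subsingleton (Ext.{w} U Z m) := by
  refine subsingleton_of_forall_eq 0 fun x => ?_
  obtain ⟨y, rfl⟩ := Ext.covariant_sequence_exact₃ U h.2 x rfl (Subsingleton.elim _ _)
  rw [Subsingleton.elim y 0, Ext.zero_comp]

lemma subsingleton_ext_covariant_mid (h : SES f g) {U : A} {m : ℕ}
    (hX : Subsingleton (Ext.{w} U X m)) (hZ : Subsingleton (Ext.{w} U Z m)) :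
    Subsingleton (Ext.{w} U Y m) := by
  refine subsingleton_of_forall_eq 0 fun x => ?_
  obtain ⟨y, rfl⟩ := Ext.covariant_sequence_exact₂ U h.2 x (Subsingleton.elim _ _)
  rw [Subsingleton.elim y 0, Ext.zero_comp]

end SES

lemma subsingleton_ext_of_iso {X Y : A} (e : X ≅ Y) {H : A} {m : ℕ}
    (h : Subsingleton (Ext.{w} X H m)) : Subsingleton (Ext.{w} Y H m) := by
  refine subsingleton_of_forall_eq 0 fun x => ?_
  have : x = (Ext.mk₀ e.inv).comp ((Ext.mk₀ e.hom).comp x (zero_add m)) (zero_add m) := by simp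
  rw [this, Subsingleton.elim ((Ext.mk₀ e.hom).comp x (zero_add m)) 0, Ext.comp_zero]

end Ext

end DCProj

namespace DCProj

open Limits ZeroObject

universe w v₁ u₁

variable {A : Type u₁} [Category.{v₁} A] [Abelian A]

/-- The tool for splicing: an epimorphism in front changes no image and a monomorphism behind
changes no kernel. -/
lemma exact_epi_comp_mono_iff {X Y Z X' Z' : A} (e : X' ⟶ X) (f : X ⟶ Y) (g : Y ⟶ Z) (m : Z ⟶ Z')
    [Epi e] [Mono m] (w : f ≫ g = 0) (w' : (e ≫ f) ≫ g ≫ m = 0) :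
    (ShortComplex.mk (e ≫ f) (g ≫ m) w').Exact ↔ (ShortComplex.mk f g w).Exact := by
  have w'' : f ≫ g ≫ m = 0 := by rw [reassoc_of% w, zero_comp]
  let φ : ShortComplex.mk (e ≫ f) (g ≫ m) w' ⟶ ShortComplex.mk f (g ≫ m) w'' :=
    { τ₁ := e, τ₂ := 𝟙 _, τ₃ := 𝟙 _ }
  let ψ : ShortComplex.mk f g w ⟶ ShortComplex.mk f (g ≫ m) w'' :=
    { τ₁ := 𝟙 _, τ₂ := 𝟙 _, τ₃ := m }
  have : Epi φ.τ₁ := ‹Epi e›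
  have : IsIso φ.τ₂ := inferInstanceAs (IsIso (𝟙 Y))
  have : Mono φ.τ₃ := inferInstanceAs (Mono (𝟙 Z'))
  have : Epi ψ.τ₁ := inferInstanceAs (Epi (𝟙 X))
  have : IsIso ψ.τ₂ := inferInstanceAs (IsIso (𝟙 Y))
  have : Mono ψ.τ₃ := ‹Mono m›
  rw [ShortComplex.exact_iff_of_epi_of_isIso_of_mono φ,
    ← ShortComplex.exact_iff_of_epi_of_isIso_of_mono ψ]

/-! ### Left resolutions, their splicing, and relative dimension. -/

section Resolution

lemma exactAt_succ_iff (G : ChainComplex A ℕ) (i : ℕ) :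
    G.ExactAt (i + 1) ↔
      (ShortComplex.mk (G.d (i + 2) (i + 1)) (G.d (i + 1) i) (G.d_comp_d _ _ _)).Exact :=
  G.exactAt_iff' (i + 2) (i + 1) i (by simp) (by simp)

lemma ExactResolution.d_comp_lift {X : A} (E : ExactResolution X) :
    E.G.d 2 1 ≫ kernel.lift E.ε (E.G.d 1 0) E.w = 0 := by
  rw [← cancel_mono (kernel.ι E.ε), Category.assoc, kernel.lift_ι, zero_comp]
  exact E.G.d_comp_d 2 1 0

/-- The exact sequence `⋯ ⟶ G 2 ⟶ G 1 ⟶ Ker ε ⟶ 0`. -/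
noncomputable def ExactResolution.tail {X : A} (E : ExactResolution X) :
    ExactResolution (kernel E.ε) where
  G := ChainComplex.truncate.obj E.G
  ε := kernel.lift E.ε (E.G.d 1 0) E.w
  w := E.d_comp_lift
  epi_ε := E.exact_zero.epi_kernelLift
  exact_zero := by
    have h := (exactAt_succ_iff E.G 0).1 (E.exact_succ 0)
    have := exact_epi_comp_mono_iff (𝟙 _) (E.G.d 2 1) (kernel.lift E.ε (E.G.d 1 0) E.w)
      (kernel.ι E.ε) E.d_comp_lift (by simp)
    refine this.1 ?_
    simpa using h
  exact_succ i := (exactAt_succ_iff _ i).2 ((exactAt_succ_iff E.G (i + 1)).1 (E.exact_succ _))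

lemma ExactResolution.ses {X : A} (E : ExactResolution X) : SES (kernel.ι E.ε) E.ε :=
  have := E.epi_ε
  SES.of_epi _

lemma ExactResolution.tail_kernelObj {X : A} (E : ExactResolution X) (n : ℕ) :
    Nonempty (E.tail.kernelObj n ≅ E.kernelObj (n + 1)) := by
  match n with
  | 0 => exact ⟨Iso.refl _⟩
  -- The augmentation of the tail is the first differential corestricted along a monomorphism, so
  -- the kernel is unchanged.
  | 1 => exact ⟨(kernelCompMono (kernel.lift E.ε (E.G.d 1 0) E.w) (kernel.ι E.ε)).symm ≪≫
      kernelIsoOfEq (kernel.lift_ι _ _ _)⟩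
  | n + 2 => exact ⟨Iso.refl _⟩

/-- Splice a short exact sequence with a resolution of its first term. -/
noncomputable def ExactResolution.cons {K Y X : A} {f : K ⟶ Y} {g : Y ⟶ X} (h : SES f g)
    (E : ExactResolution K) : ExactResolution X where
  G := E.G.augment (E.ε ≫ f) (by rw [← Category.assoc, E.w, zero_comp])
  ε := g
  w := show (E.ε ≫ f) ≫ g = 0 by rw [Category.assoc, h.zero, comp_zero]
  epi_ε := h.epi
  exact_zero := by
    have := E.epi_ε
    have h' := (exact_epi_comp_mono_iff E.ε f g (𝟙 _) h.zero (by simp [h.zero])).2 h.2.exact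
    simp only [Category.comp_id] at h'
    exact h'
  exact_succ i := by
    rw [exactAt_succ_iff]
    cases i with
    | zero =>
      have := h.mono
      have h' := (exact_epi_comp_mono_iff (𝟙 _) _ _ f E.w
        (by rw [Category.id_comp, ← Category.assoc, E.w, zero_comp])).2 E.exact_zero
      simp only [Category.id_comp] at h'
      exact h'
    | succ i => exact (exactAt_succ_iff _ i).1 (E.exact_succ i)

/-- There is an exact sequence `⋯ ⟶ G 1 ⟶ G 0 ⟶ X ⟶ 0` with `G i` in the class `p i`. -/
def SeqRes (p : ℕ → ObjectProperty A) (X : A) : Prop :=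
  ∃ E : ExactResolution X, ∀ i, p i (E.G.X i)

lemma SeqRes.cons {p : ℕ → ObjectProperty A} {K Y X : A} {f : K ⟶ Y} {g : Y ⟶ X} (h : SES f g)
    (hY : p 0 Y) (hK : SeqRes (fun i => p (i + 1)) K) : SeqRes p X := by
  obtain ⟨E, hE⟩ := hK
  refine ⟨E.cons h, fun i => ?_⟩
  cases i with
  | zero => exact hY
  | succ i => exact hE i

lemma SeqRes.uncons {p : ℕ → ObjectProperty A} {X : A} (h : SeqRes p X) :
    ∃ (K Y : A) (f : K ⟶ Y) (g : Y ⟶ X), SES f g ∧ p 0 Y ∧ SeqRes (fun i => p (i + 1)) K := by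
  obtain ⟨E, hE⟩ := h
  exact ⟨_, _, _, _, E.ses, hE 0, E.tail, fun i => hE (i + 1)⟩

lemma SeqRes.mono {p q : ℕ → ObjectProperty A} (hpq : ∀ i X, p i X → q i X) {X : A}
    (h : SeqRes p X) : SeqRes q X :=
  ⟨h.choose, fun i => hpq i _ (h.choose_spec i)⟩

lemma SeqRes.of_isZero {p : ℕ → ObjectProperty A} (hp : ∀ i X, IsZero X → p i X) {X : A}
    (hX : IsZero X) : SeqRes p X := by
  have hZ (i : ℕ) : IsZero ((0 : ChainComplex A ℕ).X i) :=
    Functor.map_isZero (HomologicalComplex.eval A _ i) (isZero_zero _)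
  exact ⟨{ G := 0
           ε := 0
           w := by simp
           epi_ε := ⟨fun _ _ _ => hX.eq_of_src _ _⟩
           exact_zero := ShortComplex.exact_of_isZero_X₂ _ (hZ 0)
           exact_succ := fun i => (exactAt_succ_iff _ _).2
             (ShortComplex.exact_of_isZero_X₂ _ (hZ _)) }, fun i => hp i _ (hZ i)⟩

variable {P : ObjectProperty A}

lemma hasResolutionOfLength_iff {X : A} {n : ℕ} : HasResolutionOfLength P X n ↔
    SeqRes (fun i Y => (i ≤ n → P Y) ∧ (n < i → IsZero Y)) X :=
  ⟨fun ⟨E, h₁, h₂⟩ => ⟨E, fun i => ⟨h₁ i, h₂ i⟩⟩,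
    fun ⟨E, h⟩ => ⟨E, fun i => (h i).1, fun i => (h i).2⟩⟩

lemma isZero_of_seqRes {p : ℕ → ObjectProperty A} (hp : ∀ X, p 0 X → IsZero X) {X : A}
    (h : SeqRes p X) : IsZero X := by
  obtain ⟨K, Y, f, g, hfg, hY, -⟩ := h.uncons
  have := hfg.epi
  exact (hp _ hY).of_epi g

lemma hasResolutionOfLength_zero_iff [P.IsClosedUnderIsomorphisms] {X : A} :
    HasResolutionOfLength P X 0 ↔ P X := by
  rw [hasResolutionOfLength_iff]
  constructor
  · intro h
    obtain ⟨K, Y, f, g, hfg, hY, hK⟩ := h.uncons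
    have := hfg.isIso_of_isZero_left (isZero_of_seqRes (fun _ hX => hX.2 (by lia)) hK)
    exact P.prop_of_iso (asIso g) (hY.1 (by lia))
  · intro h
    exact SeqRes.cons (SES.zero_id X (isZero_zero A)) ⟨fun _ => h, fun h => by lia⟩
      (SeqRes.of_isZero (fun i Y hY => ⟨fun h => by lia, fun _ => hY⟩) (isZero_zero A))

/-- With the case of length zero, this lets all later inductions run on single short exact
sequences. -/
lemma hasResolutionOfLength_succ_iff {X : A} {n : ℕ} : HasResolutionOfLength P X (n + 1) ↔
    ∃ (K Y : A) (f : K ⟶ Y) (g : Y ⟶ X), SES f g ∧ P Y ∧ HasResolutionOfLength P K n := by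
  simp_rw [hasResolutionOfLength_iff]
  constructor
  · intro h
    obtain ⟨K, Y, f, g, hfg, hY, hK⟩ := h.uncons
    exact ⟨K, Y, f, g, hfg, hY.1 (by lia),
      hK.mono fun i X h => ⟨fun _ => h.1 (by lia), fun _ => h.2 (by lia)⟩⟩
  · rintro ⟨K, Y, f, g, hfg, hY, hK⟩
    exact SeqRes.cons hfg ⟨fun _ => hY, fun h => by lia⟩
      (hK.mono fun i X h => ⟨fun _ => h.1 (by lia), fun _ => h.2 (by lia)⟩)

lemma HasResolutionOfLength.mono (hP : ∀ X, IsZero X → P X) {X : A} {m n : ℕ} (hmn : m ≤ n)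
    (h : HasResolutionOfLength P X m) : HasResolutionOfLength P X n := by
  rw [hasResolutionOfLength_iff] at h ⊢
  refine h.mono fun i Y hY => ⟨fun _ => ?_, fun _ => hY.2 (by lia)⟩
  by_cases him : i ≤ m
  · exact hY.1 him
  · exact hP _ (hY.2 (by lia))

lemma resDim_le_of_hasResolutionOfLength {X : A} {n : ℕ} (h : HasResolutionOfLength P X n) :
    resDim P X ≤ n :=
  iInf₂_le n h

lemma exists_hasResolutionOfLength_of_resDim_lt_top {X : A} (h : resDim P X < ⊤) :
    ∃ n, HasResolutionOfLength P X n := by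
  simp only [resDim, iInf_lt_top] at h
  exact ⟨h.choose, h.choose_spec.choose⟩

lemma resDim_le_iff (hP : ∀ X, IsZero X → P X) {X : A} {n : ℕ} :
    resDim P X ≤ n ↔ HasResolutionOfLength P X n := by
  refine ⟨fun h => ?_, resDim_le_of_hasResolutionOfLength⟩
  -- A strict bound on the infimum produces an actual resolution below it.
  have h' : resDim P X < (n + 1 : ℕ) := h.trans_lt (by exact_mod_cast Nat.lt_succ_self n)
  simp only [resDim, iInf_lt_iff] at h'
  obtain ⟨m, hm, hmn⟩ := h'
  exact hm.mono hP (by exact_mod_cast Nat.lt_succ_iff.1 (by exact_mod_cast hmn))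

end Resolution

end DCProj

namespace DCProj

open Limits ZeroObject

universe w v₁ u₁

variable {A : Type u₁} [Category.{v₁} A] [Abelian A]

/-! ### Unbounded exact complexes from short exact sequences, and back. -/

section Gluing

/-- Short exact sequences `0 ⟶ K i ⟶ E i ⟶ K (i - 1) ⟶ 0` for all integers `i`. -/
structure Gluing (A : Type u₁) [Category.{v₁} A] [Abelian A] where
  K : ℤ → A
  E : ℤ → A
  ι (i : ℤ) : K i ⟶ E i
  π (i j : ℤ) : E i ⟶ K j
  ses (i j : ℤ) : j + 1 = i → SES (ι i) (π i j)
  π_eq_zero (i j : ℤ) : j + 1 ≠ i → π i j = 0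

namespace Gluing

variable (D : Gluing A)

/-- The exact complex spliced from the short exact sequences of a gluing. -/
abbrev complex : ChainComplex A ℤ where
  X := D.E
  d i j := D.π i j ≫ D.ι j
  shape i j h := by rw [D.π_eq_zero i j h, zero_comp]
  d_comp_d' i j k _ hjk := by
    rw [Category.assoc, reassoc_of% (D.ses j k hjk).zero, zero_comp, comp_zero]

lemma acyclic : D.complex.Acyclic := fun i => by
  rw [D.complex.exactAt_iff' (i + 1) i (i - 1) (by simp) (by simp)]
  have := (D.ses (i + 1) i rfl).epi
  have := (D.ses (i - 1) (i - 2) (by ring)).mono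
  have h := D.ses i (i - 1) (by ring)
  exact (exact_epi_comp_mono_iff (D.π (i + 1) i) (D.ι i) (D.π i (i - 1)) (D.ι (i - 1)) h.zero
    (by rw [Category.assoc, reassoc_of% h.zero, zero_comp, comp_zero])).2 h.2.exact

/-- A map on `E i` killed by the incoming differential factors through `K (i - 1)`, and the
obstruction to extending it to `E (i - 1)` lies in `Ext¹(K (i - 2), H)`. -/
lemma isHomExact [HasExt.{w} A] {B : ObjectProperty A}
    (h : ∀ i H, B H → Subsingleton (Abelian.Ext.{w} (D.K i) H 1)) :
    IsHomExact D.complex B := by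
  intro H hH i (g : D.E i ⟶ H) (hg : (D.π (i + 1) i ≫ D.ι i) ≫ g = 0)
  have := (D.ses (i + 1) i rfl).epi
  rw [Category.assoc, ← comp_zero (X := D.E (i + 1)), cancel_epi] at hg
  obtain ⟨k, rfl⟩ := (D.ses i (i - 1) (by ring)).exists_desc g hg
  obtain ⟨l, rfl⟩ := (D.ses (i - 1) (i - 2) (by ring)).exists_extension (h _ _ hH) k
  exact ⟨l, Category.assoc _ _ _⟩

lemma nonempty_iso_image {i j : ℤ} (hij : j + 1 = i) :
    Nonempty (D.K j ≅ image (D.complex.d i j)) := by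
  have := (D.ses i j hij).epi
  have := (D.ses j (j - 1) (by ring)).mono
  have := strongEpi_of_epi (D.π i j)
  have e : D.K j ≅ image (D.π i j ≫ D.ι j) := image.isoStrongEpiMono _ _ rfl
  exact ⟨e⟩

end Gluing

lemma ses_image {E : ChainComplex A ℤ} (hE : E.Acyclic) {i j k : ℤ} (hij : j + 1 = i)
    (hjk : k + 1 = j) : SES (image.ι (E.d i j)) (factorThruImage (E.d j k)) := by
  obtain rfl : i = j + 1 := hij.symm
  obtain rfl : k = j - 1 := by lia
  have w : image.ι (E.d (j + 1) j) ≫ factorThruImage (E.d j (j - 1)) = 0 := by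
    rw [← cancel_epi (factorThruImage _), ← cancel_mono (image.ι _)]
    simp
  have h := (E.exactAt_iff' (j + 1) j (j - 1) (by simp) (by simp)).1 (hE j)
  refine ⟨w, ShortComplex.ShortExact.mk ?_⟩
  refine (exact_epi_comp_mono_iff (factorThruImage _) _ _ (image.ι _) w ?_).1 ?_
  · simp
  · simpa [HomologicalComplex.sc', HomologicalComplex.shortComplexFunctor'] using h

end Gluing

/-! ### The abstract class `totalProj` and its characterization by coresolutions. -/

section TotalProj

/-- The images of `E 0 ⟶ E (-1)` for the exact complexes `E`, exact under `Hom(-, ℋ)`, with terms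
in `𝒜` in degrees `≥ 0` and in `𝒬` in degrees `< 0`. -/
def totalProj (𝒜 𝒬 ℋ : ObjectProperty A) : ObjectProperty A :=
  fun X => ∃ E : ChainComplex A ℤ, E.Acyclic ∧ IsHomExact E ℋ ∧
    (∀ i : ℤ, 0 ≤ i → 𝒜 (E.X i)) ∧ (∀ i : ℤ, i < 0 → 𝒬 (E.X i)) ∧
    Nonempty (X ≅ image (E.d 0 (-1)))

lemma exists_right_sequence {𝒬 W : ObjectProperty A}
    (hW : ∀ X, W X → ∃ (E Y : A) (f : X ⟶ E) (g : E ⟶ Y), 𝒬 E ∧ SES f g ∧ W Y)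
    {X : A} (hX : W X) :
    ∃ K : ℕ → A, K 0 = X ∧ (∀ n, W (K n)) ∧
      ∀ n, ∃ (E : A) (f : K n ⟶ E) (g : E ⟶ K (n + 1)), 𝒬 E ∧ SES f g := by
  have step (Y : {Y : A // W Y}) : ∃ Z : {Z : A // W Z},
      ∃ (E : A) (f : Y.1 ⟶ E) (g : E ⟶ Z.1), 𝒬 E ∧ SES f g := by
    obtain ⟨E, Z, f, g, hE, hfg, hZ⟩ := hW Y.1 Y.2
    exact ⟨⟨Z, hZ⟩, E, f, g, hE, hfg⟩
  choose s hs using step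
  let K : ℕ → {Y : A // W Y} := fun n => Nat.rec ⟨X, hX⟩ (fun _ Y => s Y) n
  exact ⟨fun n => (K n).1, rfl, fun n => (K n).2, fun n => hs (K n)⟩

variable [HasExt.{w} A]

/-- The class of objects with no higher extensions by objects of `ℋ`. -/
def extPerp (ℋ : ObjectProperty A) : ObjectProperty A :=
  fun X => ∀ H, ℋ H → ∀ n : ℕ, Subsingleton (Abelian.Ext.{w} X H (n + 1))

/-- Conditions on the classes `𝒜`, `𝒬` and `ℋ` under which `totalProj 𝒜 𝒬 ℋ` is well behaved. -/
structure IsAdmissible (𝒜 𝒬 ℋ : ObjectProperty A) : Prop where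
  projective : ∀ X, 𝒜 X → Projective X
  enough : ∀ X, ∃ (Y : A) (f : Y ⟶ X), 𝒜 Y ∧ Epi f
  le : ∀ X, 𝒬 X → ℋ X
  zero : ∀ X, IsZero X → 𝒬 X
  biprod : ∀ X Y, 𝒬 X → 𝒬 Y → 𝒬 (X ⊞ Y)
  ext : ∀ X, 𝒬 X → extPerp.{w} ℋ X

variable {𝒜 𝒬 ℋ : ObjectProperty A}

instance : (totalProj 𝒜 𝒬 ℋ).IsClosedUnderIsomorphisms where
  of_iso e := fun ⟨E, h₁, h₂, h₃, h₄, ⟨i⟩⟩ => ⟨E, h₁, h₂, h₃, h₄, ⟨e.symm ≪≫ i⟩⟩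

namespace IsAdmissible

lemma extPerp_of_projective (h : IsAdmissible.{w} 𝒜 𝒬 ℋ) {X : A} (hX : 𝒜 X) : extPerp.{w} ℋ X := fun _ _ _ =>
  have := h.projective X hX
  Abelian.Ext.subsingleton_of_projective _ _ _

/-- Syzygies over `𝒜` stay in `extPerp ℋ` by dimension shifting. -/
lemma exists_left_sequence (h : IsAdmissible.{w} 𝒜 𝒬 ℋ) {X : A} (hX : extPerp.{w} ℋ X) :
    ∃ K : ℕ → A, K 0 = X ∧ (∀ n, extPerp.{w} ℋ (K n)) ∧
      ∀ n, ∃ (E : A) (f : K (n + 1) ⟶ E) (g : E ⟶ K n), 𝒜 E ∧ SES f g := by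
  have step (Y : {Y : A // extPerp.{w} ℋ Y}) : ∃ Z : {Z : A // extPerp.{w} ℋ Z},
      ∃ (E : A) (f : Z.1 ⟶ E) (g : E ⟶ Y.1), 𝒜 E ∧ SES f g := by
    obtain ⟨E, g, hE, hg⟩ := h.enough Y.1
    refine ⟨⟨kernel g, fun H hH n => ?_⟩, E, kernel.ι g, g, hE, SES.of_epi g⟩
    exact (SES.of_epi g).subsingleton_ext_left (h.extPerp_of_projective hE H hH n)
      (Y.2 H hH (n + 1))
  choose s hs using step
  let K : ℕ → {Y : A // extPerp.{w} ℋ Y} := fun n => Nat.rec ⟨X, hX⟩ (fun _ Y => s Y) n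
  exact ⟨fun n => (K n).1, rfl, fun n => (K n).2, fun n => hs (K n)⟩

/-- A class of objects of `extPerp ℋ`, each of which embeds into an object of `𝒬` with cokernel in
the class, consists of objects of `totalProj 𝒜 𝒬 ℋ`. -/
theorem totalProj_of_coresolving (h : IsAdmissible.{w} 𝒜 𝒬 ℋ) {W : ObjectProperty A} (hperp : ∀ X, W X → extPerp.{w} ℋ X)
    (hW : ∀ X, W X → ∃ (E Y : A) (f : X ⟶ E) (g : E ⟶ Y), 𝒬 E ∧ SES f g ∧ W Y)
    {X : A} (hX : W X) : totalProj 𝒜 𝒬 ℋ X := by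
  obtain ⟨L, hL₀, hL, hLs⟩ := h.exists_left_sequence (hperp X hX)
  obtain ⟨M, hM₀, hM, hMs⟩ := exists_right_sequence hW hX
  -- Both sequences start at `X`; it is placed once, as `K (-1)`, because `E 0 ⟶ E (-1)` must have
  -- image `X`. Hence the shift `L (n + 1)` in degrees `≥ 0`.
  let K : ℤ → A := fun i => match i with
    | Int.ofNat n => L (n + 1)
    | Int.negSucc n => M n
  have key (i : ℤ) : ∃ (E : A) (ι : K i ⟶ E) (π : E ⟶ K (i - 1)),
      ((0 ≤ i → 𝒜 E) ∧ (i < 0 → 𝒬 E)) ∧ SES ι π := by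
    match i with
    | Int.ofNat 0 =>
      obtain ⟨E, f, g, hE, hfg⟩ := hLs 0
      have : K (Int.ofNat 0 - 1) = L 0 := hM₀.trans hL₀.symm
      rw [this]
      exact ⟨E, f, g, ⟨fun _ => hE, fun h => absurd h (by simp)⟩, hfg⟩
    | Int.ofNat (n + 1) =>
      obtain ⟨E, f, g, hE, hfg⟩ := hLs (n + 1)
      have : Int.ofNat (n + 1) - 1 = Int.ofNat n := by simp
      rw [this]
      exact ⟨E, f, g, ⟨fun _ => hE, fun h => absurd h (by simp; lia)⟩, hfg⟩
    | Int.negSucc n =>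
      obtain ⟨E, f, g, hE, hfg⟩ := hMs n
      have : Int.negSucc n - 1 = Int.negSucc (n + 1) := by lia
      rw [this]
      exact ⟨E, f, g, ⟨fun h => absurd h (by lia), fun _ => hE⟩, hfg⟩
  choose E ι π hE hπ using key
  have key' (i j : ℤ) : ∃ π' : E i ⟶ K j, (j + 1 = i → SES (ι i) π') ∧ (j + 1 ≠ i → π' = 0) := by
    by_cases hij : j + 1 = i
    · obtain rfl : j = i - 1 := by lia
      exact ⟨π i, fun _ => hπ i, fun h => absurd hij h⟩
    · exact ⟨0, fun h => absurd h hij, fun _ => rfl⟩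
  choose π' h₁ h₂ using key'
  let D : Gluing A := ⟨K, E, ι, π', h₁, h₂⟩
  refine ⟨D.complex, D.acyclic, D.isHomExact.{w} fun i H hH => ?_, fun i => (hE i).1,
    fun i => (hE i).2, ?_⟩
  · match i with
    | Int.ofNat n => exact hL (n + 1) H hH 0
    | Int.negSucc n => exact hperp _ (hM n) H hH 0
  · obtain ⟨e⟩ := D.nonempty_iso_image (i := 0) (j := -1) (by simp)
    exact ⟨eqToIso hM₀.symm ≪≫ e⟩

/-- Hom-exactness extends maps from each syzygy to the next term, which kills Ext¹ of every image;
higher Ext follows by moving one step left in `E`. -/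
lemma extPerp_image (h : IsAdmissible.{w} 𝒜 𝒬 ℋ) {E : ChainComplex A ℤ} (hE : E.Acyclic) (hH : IsHomExact E ℋ)
    (hp : ∀ i : ℤ, 0 ≤ i → 𝒜 (E.X i)) (hq : ∀ i : ℤ, i < 0 → 𝒬 (E.X i)) (i j : ℤ)
    (hij : j + 1 = i) : extPerp.{w} ℋ (image (E.d i j)) := by
  have hX (i : ℤ) : extPerp.{w} ℋ (E.X i) := by
    by_cases hi : 0 ≤ i
    · exact h.extPerp_of_projective (hp i hi)
    · exact h.ext _ (hq i (by lia))
  intro H hHH n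
  induction n generalizing i j with
  | zero =>
    refine (ses_image hE (i := i + 1) rfl hij).subsingleton_ext_one (hX i H hHH 0) fun k => ?_
    have hex := hH H hHH (i + 1) (factorThruImage _ ≫ k) (by
      rw [← Category.assoc]
      have : E.d (i + 1 + 1) (i + 1) ≫ factorThruImage (E.d (i + 1) i) = 0 := by
        rw [← cancel_mono (image.ι _)]; simp
      rw [this, zero_comp])
    rw [add_sub_cancel_right] at hex
    obtain ⟨m, hm⟩ := hex
    refine ⟨m, ?_⟩
    rw [← cancel_epi (factorThruImage _), ← hm, ← Category.assoc, image.fac]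
  | succ n ih =>
    exact (ses_image hE (i := i + 1) rfl hij).subsingleton_ext_right (ih _ _ rfl)
      (hX i H hHH (n + 1))

lemma extPerp_of_totalProj (h : IsAdmissible.{w} 𝒜 𝒬 ℋ) {X : A} (hX : totalProj 𝒜 𝒬 ℋ X) : extPerp.{w} ℋ X := by
  obtain ⟨E, h₁, h₂, h₃, h₄, ⟨e⟩⟩ := hX
  exact fun H hH n => subsingleton_ext_of_iso e.symm (h.extPerp_image h₁ h₂ h₃ h₄ 0 (-1) (by simp)
    H hH n)

/-- A shift of `E` does not show that the cokernel is in the class, since `E (-1)` need not lie in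
`𝒜`. The coresolving criterion, applied to all images in negative degrees, supplies a new left half.
-/
lemma exists_ses_of_totalProj (h : IsAdmissible.{w} 𝒜 𝒬 ℋ) {X : A} (hX : totalProj 𝒜 𝒬 ℋ X) :
    ∃ (E Y : A) (f : X ⟶ E) (g : E ⟶ Y), 𝒬 E ∧ SES f g ∧ totalProj 𝒜 𝒬 ℋ Y := by
  obtain ⟨E, h₁, h₂, h₃, h₄, ⟨e⟩⟩ := hX
  refine ⟨_, _, _, _, h₄ (-1) (by simp),
    (ses_image h₁ (j := -1) (k := -2) rfl rfl).congr_left e, ?_⟩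
  refine h.totalProj_of_coresolving
    (W := fun Y => ∃ i j : ℤ, j + 1 = i ∧ j < 0 ∧ Nonempty (Y ≅ image (E.d i j))) ?_ ?_
    ⟨-1, -2, by simp, by simp, ⟨Iso.refl _⟩⟩
  · rintro Y ⟨i, j, hij, hj, ⟨e⟩⟩ H hH n
    exact subsingleton_ext_of_iso e.symm (h.extPerp_image h₁ h₂ h₃ h₄ i j hij H hH n)
  · rintro Y ⟨i, j, hij, hj, ⟨e⟩⟩
    exact ⟨_, _, _, _, h₄ j hj, (ses_image h₁ hij (k := j - 1) (by ring)).congr_left e,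
      j, j - 1, by ring, by lia, ⟨Iso.refl _⟩⟩

end IsAdmissible

end TotalProj

end DCProj

/-! ### Closure properties of `totalProj`, approximations, and the abstract equivalence. -/

namespace DCProj

open Limits ZeroObject

universe w v₁ u₁

variable {A : Type u₁} [Category.{v₁} A] [Abelian A]

lemma chainComplex_of_d (E : ℕ → A) (d : ∀ n, E (n + 1) ⟶ E n) (hd : ∀ n, d (n + 1) ≫ d n = 0)
    (n : ℕ) : (ChainComplex.of E d hd).d (n + 1) n = d n :=
  ChainComplex.of_d E d n

/-- The resolution of `K 0` spliced from short exact sequences `0 ⟶ K (n + 1) ⟶ E n ⟶ K n ⟶ 0`. -/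
def exactResolutionOfSES (K E : ℕ → A) (ι : ∀ n, K (n + 1) ⟶ E n) (π : ∀ n, E n ⟶ K n)
    (h : ∀ n, SES (ι n) (π n)) : ExactResolution (K 0) where
  G := ChainComplex.of E (fun n => π (n + 1) ≫ ι n) fun n => by
    rw [Category.assoc, reassoc_of% (h (n + 1)).zero, zero_comp, comp_zero]
  ε := π 0
  w := by
    rw [chainComplex_of_d, Category.assoc, (h 0).zero, comp_zero]
  epi_ε := (h 0).epi
  exact_zero := by
    have := (h 1).epi
    have h' := (exact_epi_comp_mono_iff (π 1) (ι 0) (π 0) (𝟙 _) (h 0).zero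
      (by simp [(h 0).zero])).2 (h 0).2.exact
    simp only [Category.comp_id] at h'
    convert h' using 2
    exact chainComplex_of_d ..
  exact_succ i := by
    rw [exactAt_succ_iff]
    have := (h (i + 2)).epi
    have := (h i).mono
    have h' := (exact_epi_comp_mono_iff (π (i + 2)) (ι (i + 1)) (π (i + 1)) (ι i)
      (h (i + 1)).zero (by rw [Category.assoc, reassoc_of% (h (i + 1)).zero, zero_comp,
        comp_zero])).2 (h (i + 1)).2.exact
    convert h' using 2
    · exact chainComplex_of_d ..
    · exact chainComplex_of_d ..

lemma seqRes_of_forall_exists_epi {P : ObjectProperty A}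
    (hP : ∀ X, ∃ (Y : A) (f : Y ⟶ X), P Y ∧ Epi f) (X : A) : SeqRes (fun _ => P) X := by
  choose Y f hY hf using hP
  let K : ℕ → A := fun n => Nat.rec (motive := fun _ => A) X (fun _ Z => kernel (f Z)) n
  let ι (n : ℕ) : K (n + 1) ⟶ Y (K n) := kernel.ι (f (K n))
  have h (n : ℕ) : SES (ι n) (f (K n)) :=
    have := hf (K n)
    SES.of_epi (f (K n))
  exact ⟨exactResolutionOfSES K (fun n => Y (K n)) ι (fun n => f (K n)) h, fun i => hY (K i)⟩

lemma hasResolution_of_kernelObj {P : ObjectProperty A} [P.IsClosedUnderIsomorphisms]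
    {X : A} (E : ExactResolution X) {n : ℕ}
    (hE : ∀ i, P (E.G.X i)) (hK : P (E.kernelObj n)) : HasResolutionOfLength P X n := by
  induction n generalizing X with
  | zero => exact hasResolutionOfLength_zero_iff.2 hK
  | succ n ih =>
    obtain ⟨e⟩ := E.tail_kernelObj n
    exact hasResolutionOfLength_succ_iff.2 ⟨_, _, _, _, E.ses, hE 0,
      ih E.tail (fun i => hE (i + 1)) (P.prop_of_iso e.symm hK)⟩

variable [HasExt.{w} A]

variable {𝒜 𝒬 ℋ : ObjectProperty A}

namespace IsAdmissible

lemma totalProj_of_embedding (h : IsAdmissible.{w} 𝒜 𝒬 ℋ) {X Y Z : A} {f : X ⟶ Y} {g : Y ⟶ Z}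
    (hfg : SES f g) (hX : extPerp.{w} ℋ X) (hY : 𝒬 Y) (hZ : totalProj 𝒜 𝒬 ℋ Z) :
    totalProj 𝒜 𝒬 ℋ X := by
  refine h.totalProj_of_coresolving (W := fun U => extPerp.{w} ℋ U ∧
    ∃ (E Y : A) (f : U ⟶ E) (g : E ⟶ Y), 𝒬 E ∧ SES f g ∧ totalProj 𝒜 𝒬 ℋ Y)
    (fun U hU => hU.1) ?_ ⟨hX, _, _, f, g, hY, hfg, hZ⟩
  rintro U ⟨-, E, Y, f, g, hE, hfg, hY⟩
  exact ⟨E, Y, f, g, hE, hfg, h.extPerp_of_totalProj hY, h.exists_ses_of_totalProj hY⟩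

/-- A horseshoe argument on the right: extensions are themselves a coresolving class. -/
lemma totalProj_mid (h : IsAdmissible.{w} 𝒜 𝒬 ℋ) {X Y Z : A} {f : X ⟶ Y} {g : Y ⟶ Z}
    (hfg : SES f g) (hX : totalProj 𝒜 𝒬 ℋ X) (hZ : totalProj 𝒜 𝒬 ℋ Z) : totalProj 𝒜 𝒬 ℋ Y := by
  refine h.totalProj_of_coresolving (W := fun Y => ∃ (X Z : A) (f : X ⟶ Y) (g : Y ⟶ Z),
    SES f g ∧ totalProj 𝒜 𝒬 ℋ X ∧ totalProj 𝒜 𝒬 ℋ Z) ?_ ?_ ⟨X, Z, f, g, hfg, hX, hZ⟩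
  · rintro Y ⟨X, Z, f, g, hfg, hX, hZ⟩ H hH n
    exact hfg.subsingleton_ext_mid (h.extPerp_of_totalProj hX H hH n)
      (h.extPerp_of_totalProj hZ H hH n)
  · rintro Y ⟨X, Z, f, g, hfg, hX, hZ⟩
    obtain ⟨E, X', i, p, hE, hip, hX'⟩ := h.exists_ses_of_totalProj hX
    obtain ⟨F, Z', j, q, hF, hjq, hZ'⟩ := h.exists_ses_of_totalProj hZ
    obtain ⟨T, inl, inr, b, c, h₁, h₂⟩ := hfg.pushout_mono hip
    -- `Ext¹(Z, E) = 0` splits the pushout as `E ⊞ Z`, which embeds into `E ⊞ F`; the cokernel of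
    -- `Y` there is an extension of `Z'` by `X'`.
    obtain ⟨r, hr⟩ := h₁.exists_extension (h.extPerp_of_totalProj hZ E (h.le _ hE) 0) (𝟙 E)
    obtain ⟨e⟩ := h₁.nonempty_iso_biprod_of_retraction r hr
    obtain ⟨P, inl', inr', b', h₃, h₄⟩ := ((hjq.biprod_left' E).congr_left e).pushout_epi h₂
    exact ⟨_, P, _, _, h.biprod _ _ hE hF, h₄, _, _, _, _, h₃, hX', hZ'⟩

lemma totalProj_of_mem (h : IsAdmissible.{w} 𝒜 𝒬 ℋ) {X : A} (hX : 𝒬 X) : totalProj 𝒜 𝒬 ℋ X :=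
  h.totalProj_of_coresolving (W := 𝒬) h.ext
    (fun X hX => ⟨X, 0, 𝟙 X, 0, hX, SES.id_zero X (isZero_zero A), h.zero _ (isZero_zero A)⟩) hX

lemma totalProj_of_isZero (h : IsAdmissible.{w} 𝒜 𝒬 ℋ) (X : A) (hX : IsZero X) :
    totalProj 𝒜 𝒬 ℋ X :=
  h.totalProj_of_mem (h.zero X hX)

lemma totalProj_biprod (h : IsAdmissible.{w} 𝒜 𝒬 ℋ) {X Y : A} (hX : totalProj 𝒜 𝒬 ℋ X)
    (hY : totalProj 𝒜 𝒬 ℋ Y) : totalProj 𝒜 𝒬 ℋ (X ⊞ Y) :=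
  h.totalProj_mid (SES.biprod X Y) hX hY

/-- Embed `Y` into `E` in `𝒬`; then `E / X` is an extension of `E / Y` by `Z`, hence in the class.
-/
lemma totalProj_left (h : IsAdmissible.{w} 𝒜 𝒬 ℋ) {X Y Z : A} {f : X ⟶ Y} {g : Y ⟶ Z}
    (hfg : SES f g) (hY : totalProj 𝒜 𝒬 ℋ Y) (hZ : totalProj 𝒜 𝒬 ℋ Z) : totalProj 𝒜 𝒬 ℋ X := by
  obtain ⟨E, Y', i, p, hE, hip, hY'⟩ := h.exists_ses_of_totalProj hY
  obtain ⟨P, inl, inr, b, h₁, h₂⟩ := hip.pushout_epi hfg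
  exact h.totalProj_of_embedding h₂ (fun H hH n => hfg.subsingleton_ext_left
    (h.extPerp_of_totalProj hY H hH n) (h.extPerp_of_totalProj hZ H hH (n + 1))) hE
    (h.totalProj_mid h₁ hZ hY')

/-- Pushing out along an embedding of the first syzygy into `E` in `𝒬` gives an extension of `X` by
`E`, which splits. Then `X` is the kernel of `E ⊞ X ⟶ E`, so closure under direct summands is not
needed. -/
lemma totalProj_of_hasResolution (h : IsAdmissible.{w} 𝒜 𝒬 ℋ) {X : A} {n : ℕ}
    (hX : HasResolutionOfLength (totalProj 𝒜 𝒬 ℋ) X n) (hX' : extPerp.{w} ℋ X) :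
    totalProj 𝒜 𝒬 ℋ X := by
  induction n generalizing X with
  | zero => exact hasResolutionOfLength_zero_iff.1 hX
  | succ n ih =>
    obtain ⟨K, Y, f, g, hfg, hY, hK⟩ := hasResolutionOfLength_succ_iff.1 hX
    have hK' : totalProj 𝒜 𝒬 ℋ K := ih hK fun H hH n => hfg.subsingleton_ext_left
      (h.extPerp_of_totalProj hY H hH n) (hX' H hH (n + 1))
    obtain ⟨E, K', i, p, hE, hip, hK''⟩ := h.exists_ses_of_totalProj hK'
    obtain ⟨T, inl, inr, b, c, h₁, h₂⟩ := hfg.pushout_mono hip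
    obtain ⟨r, hr⟩ := h₁.exists_extension (hX' E (h.le _ hE) 0) (𝟙 E)
    obtain ⟨e⟩ := h₁.nonempty_iso_biprod_of_retraction r hr
    have hT : totalProj 𝒜 𝒬 ℋ (E ⊞ X) := (totalProj 𝒜 𝒬 ℋ).prop_of_iso e
      (h.totalProj_mid h₂ hY hK'')
    exact h.totalProj_left (SES.biprod_inr_fst E X) hT (h.totalProj_of_mem hE)

/-- The extension becomes split after pulling back to an `𝒜`-cover `P` of `Z`, so `P ⊞ G` covers
`Y`. The kernel of this cover is an extension of `ker q` by `K`, to which induction applies. -/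
lemma hasResolution_mid (h : IsAdmissible.{w} 𝒜 𝒬 ℋ) (hA : ∀ X, 𝒜 X → totalProj 𝒜 𝒬 ℋ X)
    {X Y Z : A} {f : X ⟶ Y} {g : Y ⟶ Z} (hfg : SES f g) {n : ℕ}
    (hX : HasResolutionOfLength (totalProj 𝒜 𝒬 ℋ) X n) (hZ : totalProj 𝒜 𝒬 ℋ Z) :
    HasResolutionOfLength (totalProj 𝒜 𝒬 ℋ) Y n := by
  induction n generalizing X Y Z with
  | zero =>
    rw [hasResolutionOfLength_zero_iff] at hX ⊢
    exact h.totalProj_mid hfg hX hZ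
  | succ n ih =>
    obtain ⟨K, G, i, p, hip, hG, hK⟩ := hasResolutionOfLength_succ_iff.1 hX
    obtain ⟨P, q, hP, hq⟩ := h.enough Z
    have := h.projective P hP
    obtain ⟨T, fst, snd, b, c, h₁, h₂⟩ := hfg.pullback_epi (SES.of_epi q)
    have := h₁.epi
    obtain ⟨e⟩ := h₁.nonempty_iso_biprod_of_section (Projective.factorThru (𝟙 P) snd)
      (Projective.factorThru_comp _ _)
    let e' : P ⊞ X ≅ T := biprod.braiding _ _ ≪≫ e.symm
    have hKG := (hip.biprod_left P).congr_right e'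
    obtain ⟨M, fst', snd', b', h₃, h₄⟩ := hKG.pullback_mono h₂
    exact hasResolutionOfLength_succ_iff.2 ⟨M, _, _, _, h₄, h.totalProj_biprod (hA P hP) hG,
      ih h₃ hK (h.totalProj_left (SES.of_epi q) (hA P hP) hZ)⟩

/-- The preimage of `X` in the first term `G` of a resolution of `Y` is the kernel of `G ⟶ Z`, and
it covers `X` with the same syzygy. -/
lemma hasResolution_left (h : IsAdmissible.{w} 𝒜 𝒬 ℋ)
    {X Y Z : A} {f : X ⟶ Y} {g : Y ⟶ Z} (hfg : SES f g) {n : ℕ}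
    (hY : HasResolutionOfLength (totalProj 𝒜 𝒬 ℋ) Y n) (hZ : totalProj 𝒜 𝒬 ℋ Z) :
    HasResolutionOfLength (totalProj 𝒜 𝒬 ℋ) X n := by
  cases n with
  | zero =>
    rw [hasResolutionOfLength_zero_iff] at hY ⊢
    exact h.totalProj_left hfg hY hZ
  | succ n =>
    obtain ⟨K, G, i, p, hip, hG, hK⟩ := hasResolutionOfLength_succ_iff.1 hY
    obtain ⟨M, fst', snd', b', h₃, h₄⟩ := hip.pullback_mono hfg
    exact hasResolutionOfLength_succ_iff.2 ⟨K, M, _, _, h₃, h.totalProj_left h₄ hG hZ, hK⟩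

/-- A Schanuel comparison: the fibre product of `Y` and `G` over `Z` is an extension of `Y` by `K`
and of `G` by `X`. -/
lemma hasResolution_kernel (h : IsAdmissible.{w} 𝒜 𝒬 ℋ) (hA : ∀ X, 𝒜 X → totalProj 𝒜 𝒬 ℋ X)
    {X Y Z : A} {f : X ⟶ Y} {g : Y ⟶ Z} (hfg : SES f g) {n : ℕ} (hY : totalProj 𝒜 𝒬 ℋ Y)
    (hZ : HasResolutionOfLength (totalProj 𝒜 𝒬 ℋ) Z (n + 1)) :
    HasResolutionOfLength (totalProj 𝒜 𝒬 ℋ) X n := by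
  obtain ⟨K, G, i, p, hip, hG, hK⟩ := hasResolutionOfLength_succ_iff.1 hZ
  obtain ⟨T, fst, snd, b, c, h₁, h₂⟩ := hip.pullback_epi hfg
  exact h.hasResolution_left h₂ (h.hasResolution_mid hA h₁ hK hY) hG

/-- Auslander–Buchweitz approximation: embed the approximation `G` of the syzygy into `E` in `𝒬`,
replace the syzygy by `E / K`, and push out. The new middle term is an extension of `G'` by `G₀`. -/
lemma exists_approximation (h : IsAdmissible.{w} 𝒜 𝒬 ℋ) {X : A} {n : ℕ}
    (hX : HasResolutionOfLength (totalProj 𝒜 𝒬 ℋ) X n) :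
    ∃ (K G : A) (f : K ⟶ G) (g : G ⟶ X), SES f g ∧ totalProj 𝒜 𝒬 ℋ G ∧
      SeqRes (fun i U => (i < n → 𝒬 U) ∧ (n ≤ i → IsZero U)) K := by
  induction n generalizing X with
  | zero =>
    exact ⟨0, X, 0, 𝟙 X, SES.zero_id X (isZero_zero A), hasResolutionOfLength_zero_iff.1 hX,
      SeqRes.of_isZero (fun i U hU => ⟨fun h => by lia, fun _ => hU⟩) (isZero_zero A)⟩
  | succ n ih =>
    obtain ⟨X', G₀, i, p, hip, hG₀, hX'⟩ := hasResolutionOfLength_succ_iff.1 hX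
    obtain ⟨K, G, f, g, hfg, hG, hK⟩ := ih hX'
    obtain ⟨E, G', j, q, hE, hjq, hG'⟩ := h.exists_ses_of_totalProj hG
    obtain ⟨X'', inl, inr, b, h₁, h₂⟩ := hjq.pushout_epi hfg
    obtain ⟨T, inl', inr', b', c', h₃, h₄⟩ := hip.pushout_mono h₁
    refine ⟨X'', T, inr', b', h₃, h.totalProj_mid h₄ hG₀ hG', SeqRes.cons h₂ ?_ ?_⟩
    · exact ⟨fun _ => hE, fun h => by lia⟩
    · exact hK.mono fun i U hU => ⟨fun _ => hU.1 (by lia), fun _ => hU.2 (by lia)⟩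

lemma subsingleton_ext_of_hasResolution (h : IsAdmissible.{w} 𝒜 𝒬 ℋ) {X : A} {n : ℕ}
    (hX : HasResolutionOfLength (totalProj 𝒜 𝒬 ℋ) X n) {m : ℕ} (hm : n < m) {H : A} (hH : ℋ H) :
    Subsingleton (Abelian.Ext.{w} X H m) := by
  obtain ⟨m, rfl⟩ : ∃ k, m = k + 1 := ⟨m - 1, by lia⟩
  induction n generalizing X m with
  | zero => exact h.extPerp_of_totalProj (hasResolutionOfLength_zero_iff.1 hX) H hH m
  | succ n ih =>
    obtain ⟨K, G, i, p, hip, hG, hK⟩ := hasResolutionOfLength_succ_iff.1 hX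
    obtain ⟨m, rfl⟩ : ∃ k, m = k + 1 := ⟨m - 1, by lia⟩
    exact hip.subsingleton_ext_right (ih hK _ (by lia)) (h.extPerp_of_totalProj hG H hH (m + 1))

lemma subsingleton_ext_of_resolution_right [ℋ.IsClosedUnderIsomorphisms] {X : A} {n : ℕ}
    (hX : ∀ m : ℕ, n < m → ∀ H, ℋ H → Subsingleton (Abelian.Ext.{w} X H m)) {H : A} {k : ℕ}
    (hH : HasResolutionOfLength ℋ H k) {m : ℕ} (hm : n < m) :
    Subsingleton (Abelian.Ext.{w} X H m) := by
  induction k generalizing H m with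
  | zero => exact hX m hm H (hasResolutionOfLength_zero_iff.1 hH)
  | succ k ih =>
    obtain ⟨K, G, i, p, hip, hG, hK⟩ := hasResolutionOfLength_succ_iff.1 hH
    exact hip.subsingleton_ext_covariant_right (hX m hm G hG) (ih hK (by lia))

lemma totalProj_kernelObj (h : IsAdmissible.{w} 𝒜 𝒬 ℋ) (hA : ∀ X, 𝒜 X → totalProj 𝒜 𝒬 ℋ X)
    {X : A} {n N : ℕ} (hX : HasResolutionOfLength (totalProj 𝒜 𝒬 ℋ) X N)
    (hX' : ∀ m : ℕ, n < m → ∀ H, ℋ H → Subsingleton (Abelian.Ext.{w} X H m))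
    (E : ExactResolution X) (hE : ∀ i, totalProj 𝒜 𝒬 ℋ (E.G.X i)) :
    totalProj 𝒜 𝒬 ℋ (E.kernelObj n) := by
  induction n generalizing X with
  | zero => exact h.totalProj_of_hasResolution hX fun H hH m => hX' (m + 1) (by lia) H hH
  | succ n ih =>
    obtain ⟨e⟩ := E.tail_kernelObj n
    refine (totalProj 𝒜 𝒬 ℋ).prop_of_iso e (ih ?_ (fun m hm H hH => ?_) E.tail
      fun i => hE (i + 1))
    · exact h.hasResolution_kernel hA E.ses (hE 0)
        -- The bound `N` is padded to `N + 1` so that the kernel has bound `N` again; only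
        -- finiteness matters.
        (hX.mono h.totalProj_of_isZero (Nat.le_succ N))
    · obtain ⟨m, rfl⟩ : ∃ k, m = k + 1 := ⟨m - 1, by lia⟩
      exact E.ses.subsingleton_ext_left (h.extPerp_of_totalProj (hE 0) H hH m)
        (hX' (m + 2) (by lia) H hH)

/-- Take `t` syzygies over `𝒜`, each lowering the dimension bound by one, then approximate the last
one. -/
lemma exists_mixed_resolution (h : IsAdmissible.{w} 𝒜 𝒬 ℋ)
    (hA : ∀ X, 𝒜 X → totalProj 𝒜 𝒬 ℋ X) {X : A} {n t : ℕ} (ht : t ≤ n)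
    (hX : HasResolutionOfLength (totalProj 𝒜 𝒬 ℋ) X n) :
    SeqRes (fun i U => (i < t → 𝒜 U) ∧ (i = t → totalProj 𝒜 𝒬 ℋ U) ∧ (t < i → i ≤ n → 𝒬 U) ∧
      (n < i → IsZero U)) X := by
  induction t generalizing X n with
  | zero =>
    obtain ⟨K, G, f, g, hfg, hG, hK⟩ := h.exists_approximation hX
    refine SeqRes.cons hfg ⟨by lia, fun _ => hG, by lia, by lia⟩ (hK.mono fun i U hU => ?_)
    exact ⟨by lia, by lia, fun _ _ => hU.1 (by lia), fun _ => hU.2 (by lia)⟩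
  | succ t ih =>
    obtain ⟨n, rfl⟩ : ∃ k, n = k + 1 := ⟨n - 1, by lia⟩
    obtain ⟨P, f, hP, hf⟩ := h.enough X
    have := ih (n := n) (by lia) (h.hasResolution_kernel hA (SES.of_epi f) (hA P hP) hX)
    refine SeqRes.cons (SES.of_epi f) ⟨fun _ => hP, by lia, by lia, by lia⟩
      (this.mono fun i U hU => ?_)
    exact ⟨fun _ => hU.1 (by lia), fun _ => hU.2.1 (by lia), fun _ _ => hU.2.2.1 (by lia) (by lia),
      fun _ => hU.2.2.2 (by lia)⟩

/-- `hA` stays outside `IsAdmissible` because its verification for complexes uses the coresolving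
criterion, which presupposes admissibility. -/
theorem tfae (h : IsAdmissible.{w} 𝒜 𝒬 ℋ) [ℋ.IsClosedUnderIsomorphisms]
    (hA : ∀ X, 𝒜 X → totalProj 𝒜 𝒬 ℋ X) (X : A) (n : ℕ) :
    List.TFAE [
      resDim (totalProj 𝒜 𝒬 ℋ) X ≤ n,
      resDim (totalProj 𝒜 𝒬 ℋ) X < ⊤ ∧ ∀ m : ℕ, n < m → ∀ H : A, resDim ℋ H < ⊤ →
        Subsingleton (Abelian.Ext.{w} X H m),
      resDim (totalProj 𝒜 𝒬 ℋ) X < ⊤ ∧ ∀ m : ℕ, n < m → ∀ H : A, ℋ H →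
        Subsingleton (Abelian.Ext.{w} X H m),
      ∀ E : ExactResolution X, (∀ i : ℕ, totalProj 𝒜 𝒬 ℋ (E.G.X i)) →
        totalProj 𝒜 𝒬 ℋ (E.kernelObj n),
      ∀ t : ℕ, t ≤ n → ∃ E : ExactResolution X,
        (∀ i : ℕ, i < t → 𝒜 (E.G.X i)) ∧
        totalProj 𝒜 𝒬 ℋ (E.G.X t) ∧
        (∀ i : ℕ, t < i → i ≤ n → 𝒬 (E.G.X i)) ∧
        ∀ i : ℕ, n < i → IsZero (E.G.X i)] := by
  tfae_have 1 → 2 := fun h₁ => ⟨h₁.trans_lt (ENat.natCast_lt_top n), fun m hm H hH => by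
    obtain ⟨k, hk⟩ := exists_hasResolutionOfLength_of_resDim_lt_top hH
    rw [resDim_le_iff h.totalProj_of_isZero] at h₁
    exact subsingleton_ext_of_resolution_right
      (fun m hm H hH => h.subsingleton_ext_of_hasResolution h₁ hm hH) hk hm⟩
  tfae_have 2 → 3 := fun ⟨h₁, h₂⟩ => ⟨h₁, fun m hm H hH => h₂ m hm H <|
    (resDim_le_of_hasResolutionOfLength (n := 0) (hasResolutionOfLength_zero_iff.2 hH)).trans_lt
      (ENat.natCast_lt_top 0)⟩
  tfae_have 3 → 4 := fun ⟨h₁, h₂⟩ E hE => by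
    obtain ⟨k, hk⟩ := exists_hasResolutionOfLength_of_resDim_lt_top h₁
    exact h.totalProj_kernelObj hA hk h₂ E hE
  tfae_have 4 → 1 := fun h₄ => by
    obtain ⟨E, hE⟩ := seqRes_of_forall_exists_epi h.enough X
    exact resDim_le_of_hasResolutionOfLength (hasResolution_of_kernelObj E (fun i => hA _ (hE i))
      (h₄ E fun i => hA _ (hE i)))
  tfae_have 1 → 5 := fun h₁ t ht => by
    obtain ⟨E, hE⟩ := h.exists_mixed_resolution hA ht ((resDim_le_iff h.totalProj_of_isZero).1 h₁)
    exact ⟨E, fun i => (hE i).1, (hE t).2.1 rfl, fun i => (hE i).2.2.1, fun i => (hE i).2.2.2⟩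
  tfae_have 5 → 1 := fun h₅ => by
    obtain ⟨E, h₁, h₂, -, h₄⟩ := h₅ n le_rfl
    refine resDim_le_of_hasResolutionOfLength ⟨E, fun i hi => ?_, h₄⟩
    obtain hi | rfl := hi.lt_or_eq
    · exact hA _ (h₁ i hi)
    · exact h₂
  tfae_finish

end IsAdmissible

end DCProj

/-! ### Sums of disk complexes: maps out of them, splitting, and Ext. -/

namespace DCProj

open Limits ZeroObject

universe w w' v₁ u₁

variable {B : Type u₁} [Category.{v₁} B] [Abelian B]

namespace SES

lemma isIso_desc {X Y Z : B} {f : X ⟶ Y} {g : Y ⟶ Z} (h : SES f g) (s : Z ⟶ Y)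
    (hs : s ≫ g = 𝟙 Z) : IsIso (biprod.desc f s) := by
  let σ := ShortComplex.Splitting.ofExactOfSection _ h.2.exact s hs h.mono
  have h₁ : f ≫ σ.r = 𝟙 X := σ.f_r
  have h₂ : s ≫ σ.r = 0 := σ.s_r
  have h₃ : σ.r ≫ f + g ≫ s = 𝟙 Y := σ.id
  refine ⟨biprod.lift σ.r g, ?_, ?_⟩
  · ext <;> simp [h₁, h₂, hs, h.zero]
  · simpa using h₃

lemma biprod_map {X Y Z X' Y' Z' : B} {f : X ⟶ Y} {g : Y ⟶ Z} {f' : X' ⟶ Y'} {g' : Y' ⟶ Z'}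
    (h : SES f g) (h' : SES f' g') : SES (biprod.map f f') (biprod.map g g') := by
  have := h.mono
  have := h.epi
  have := h'.mono
  have := h'.epi
  refine of_desc (by ext <;> simp [h.zero, h'.zero]) fun k hk => ?_
  obtain ⟨l, hl⟩ := h.exists_desc (biprod.inl ≫ k) (by simpa using biprod.inl ≫= hk)
  obtain ⟨l', hl'⟩ := h'.exists_desc (biprod.inr ≫ k) (by simpa using biprod.inr ≫= hk)
  exact ⟨biprod.desc l l', by ext <;> simp [hl, hl']⟩

end SES

lemma ses_cycles {X : ChainComplex B ℤ} (hX : X.Acyclic) {i j : ℤ} (hij : j + 1 = i) :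
    SES (X.iCycles i) (X.toCycles i j) := by
  have h := hX j
  have : Epi (X.toCycles i j) := by
    rw [epi_iff_surjective_up_to_refinements]
    intro T z
    obtain ⟨T', p, hp, x, hx⟩ := (X.exactAt_iff_exact_up_to_refinements i j (j - 1)
      (by simp [hij]) (by simp)).1 h (z ≫ X.iCycles j) (by simp)
    exact ⟨T', p, hp, x, by simpa [← cancel_mono (X.iCycles j)] using hx⟩
  have w : X.iCycles i ≫ X.toCycles i j = 0 := by
    rw [← cancel_mono (X.iCycles j)]; simp
  refine ⟨w, ShortComplex.ShortExact.mk ?_⟩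
  refine ShortComplex.exact_of_f_is_kernel _ (KernelFork.IsLimit.ofι' _ _ fun k hk => ?_)
  exact ⟨X.liftCycles k j ((ComplexShape.down ℤ).next_eq' hij) (by
    rw [← X.toCycles_i i j, reassoc_of% hk, zero_comp]), by simp⟩

/-- The cycles of the complex spliced from the short exact sequences of a gluing. -/
lemma Gluing.nonempty_cycles_iso (D : Gluing B) (i : ℤ) :
    Nonempty (D.complex.cycles i ≅ D.K i) := by
  have h := D.ses i (i - 1) (by ring)
  have := (D.ses (i - 1) (i - 2) (by ring)).mono
  have := h.mono
  have w : D.ι i ≫ D.complex.d i (i - 1) = 0 := by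
    change D.ι i ≫ D.π i (i - 1) ≫ D.ι (i - 1) = 0
    rw [reassoc_of% h.zero, zero_comp]
  obtain ⟨l, hl⟩ := h.exists_lift (D.complex.iCycles i) (by
    rw [← cancel_mono (D.ι (i - 1)), zero_comp, Category.assoc]
    exact D.complex.iCycles_d i (i - 1))
  refine ⟨⟨l, D.complex.liftCycles (D.ι i) (i - 1) (by simp) w, ?_, ?_⟩⟩
  · rw [← cancel_mono (D.complex.iCycles i), Category.assoc,
      HomologicalComplex.liftCycles_i, Category.id_comp]
    exact hl
  · rw [← cancel_mono (D.ι i), Category.assoc, hl, HomologicalComplex.liftCycles_i,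
      Category.id_comp]

section Disk

/-- The morphism `M i ⟶ M j` which is the identity if `i = j` and zero otherwise. -/
noncomputable def transport (M : ℤ → B) (i j : ℤ) : M i ⟶ M j :=
  if h : i = j then eqToHom (congrArg M h) else 0

@[simp]
lemma transport_self (M : ℤ → B) (i : ℤ) : transport M i i = 𝟙 _ := by
  simp [transport]

lemma transport_of_ne (M : ℤ → B) {i j : ℤ} (h : i ≠ j) : transport M i j = 0 := by
  simp [transport, h]

lemma transport_naturality {M N : ℤ → B} (φ : ∀ i, M i ⟶ N i) (i j : ℤ) :
    transport M i j ≫ φ j = φ i ≫ transport N i j := by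
  by_cases h : i = j
  · subst h; simp
  · simp [transport_of_ne _ h]

lemma transport_comp (M : ℤ → B) {i j k : ℤ} (h : i = j) :
    transport M i j ≫ transport M j k = transport M i k := by
  subst h; simp

/-- The short exact sequences `0 ⟶ M i ⟶ M i ⊞ M (i - 1) ⟶ M (i - 1) ⟶ 0`. -/
noncomputable abbrev diskGluing (M : ℤ → B) : Gluing B where
  K := M
  E i := M i ⊞ M (i - 1)
  ι i := biprod.inl
  π i j := biprod.snd ≫ transport M (i - 1) j
  ses i j h := by
    obtain rfl : j = i - 1 := by lia
    simpa using SES.biprod (M i) (M (i - 1))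
  π_eq_zero i j h := by rw [transport_of_ne M (by lia), comp_zero]

/-- The direct sum over `i` of the complexes `0 ⟶ M i ⟶ M i ⟶ 0` in degrees `i + 1` and `i`. -/
noncomputable abbrev disk (M : ℤ → B) : ChainComplex B ℤ := (diskGluing M).complex

/-- The inclusion of `M j` as the second summand of the `(j + 1)`-st term. -/
noncomputable def diskInr (M : ℤ → B) (i j : ℤ) : M j ⟶ (disk M).X i :=
  transport M j (i - 1) ≫ (biprod.inr : M (i - 1) ⟶ M i ⊞ M (i - 1))

lemma diskInr_eq (M : ℤ → B) (i : ℤ) :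
    diskInr M i (i - 1) = (biprod.inr : M (i - 1) ⟶ M i ⊞ M (i - 1)) := by
  simp [diskInr]

lemma diskInr_d (M : ℤ → B) (i j : ℤ) (h : j + 1 = i) :
    diskInr M i j ≫ (disk M).d i j = (biprod.inl : M j ⟶ M j ⊞ M (j - 1)) := by
  change (transport M j (i - 1) ≫ (biprod.inr : M (i - 1) ⟶ M i ⊞ M (i - 1))) ≫
    (biprod.snd ≫ transport M (i - 1) j) ≫ biprod.inl = _
  have : transport M j (i - 1) ≫ transport M (i - 1) j = 𝟙 _ := by
    rw [transport_comp _ (by lia), transport_self]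
  simp [reassoc_of% this]

lemma disk_d_self (M : ℤ → B) (i : ℤ) :
    (disk M).d i (i - 1) = (biprod.snd : M i ⊞ M (i - 1) ⟶ _) ≫
      (biprod.inl : M (i - 1) ⟶ M (i - 1) ⊞ M (i - 1 - 1)) := by
  change ((biprod.snd : M i ⊞ M (i - 1) ⟶ _) ≫ transport M (i - 1) (i - 1)) ≫ biprod.inl = _
  simp

/-- The second summands generate: the first summand in degree `i` is the differential of the second
one in degree `i + 1`. Together with `diskDesc`, maps out of `disk M` are families `M j ⟶ H.X (j +
1)`. -/
lemma disk_hom_ext {M : ℤ → B} {H : ChainComplex B ℤ} {f g : disk M ⟶ H}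
    (h : ∀ i j, j + 1 = i → diskInr M i j ≫ f.f i = diskInr M i j ≫ g.f i) : f = g := by
  refine HomologicalComplex.hom_ext _ _ fun i => ?_
  refine biprod.hom_ext' (X := M i) (Y := M (i - 1)) (f.f i) (g.f i) ?_ ?_
  · rw [← diskInr_d M (i + 1) i rfl]
    have key (k : disk M ⟶ H) : (diskInr M (i + 1) i ≫ (disk M).d (i + 1) i) ≫ k.f i =
        (diskInr M (i + 1) i ≫ k.f (i + 1)) ≫ H.d (i + 1) i :=
      (Category.assoc _ _ _).trans ((congrArg (diskInr M (i + 1) i ≫ ·) (k.comm _ _).symm).trans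
        (Category.assoc _ _ _).symm)
    rw [key f, key g, h (i + 1) i rfl]
  · have h' := h i (i - 1) (by ring)
    rwa [diskInr_eq] at h'

/-- The morphism from `disk M` given by morphisms `M j ⟶ H (j + 1)`. -/
noncomputable def diskDesc {M : ℤ → B} {H : ChainComplex B ℤ}
    (g : ∀ i j, j + 1 = i → (M j ⟶ H.X i)) : disk M ⟶ H where
  f i := biprod.desc (g (i + 1) i rfl ≫ H.d (i + 1) i) (g i (i - 1) (by ring))
  comm' i j hij := by
    obtain rfl : j = i - 1 := by simp at hij; lia
    rw [disk_d_self]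
    -- The components of `diskDesc` in degree `i - 1` use the index `i - 1 + 1`, which must be
    -- replaced by `i`.
    have : ∀ k (hk : k = i), g k (i - 1) (by lia) ≫ H.d k (i - 1) =
        g i (i - 1) (by lia) ≫ H.d i (i - 1) := by
      rintro k rfl; rfl
    refine biprod.hom_ext' (X := M i) (Y := M (i - 1)) _ _ ?_ ?_
    · simp
    · simp [this (i - 1 + 1) (by ring)]

lemma diskDesc_f {M : ℤ → B} {H : ChainComplex B ℤ} (g : ∀ i j, j + 1 = i → (M j ⟶ H.X i))
    (i : ℤ) : (diskDesc g).f i =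
      biprod.desc (g (i + 1) i rfl ≫ H.d (i + 1) i) (g i (i - 1) (by ring)) :=
  rfl

lemma diskInr_diskDesc {M : ℤ → B} {H : ChainComplex B ℤ} (g : ∀ i j, j + 1 = i → (M j ⟶ H.X i))
    (i j : ℤ) (h : j + 1 = i) : diskInr M i j ≫ (diskDesc g).f i = g i j h := by
  obtain rfl : j = i - 1 := by lia
  rw [diskInr_eq, diskDesc_f, biprod.inr_desc]

/-- The morphism `disk M ⟶ disk N` induced by morphisms `M i ⟶ N i`. -/
noncomputable def diskMap {M N : ℤ → B} (φ : ∀ i, M i ⟶ N i) : disk M ⟶ disk N where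
  f i := biprod.map (φ i) (φ (i - 1))
  comm' i j hij := by
    obtain rfl : j = i - 1 := by simp at hij; lia
    rw [disk_d_self, disk_d_self]
    refine biprod.hom_ext' (X := M i) (Y := M (i - 1)) _ _ ?_ ?_ <;> simp

lemma diskMap_f {M N : ℤ → B} (φ : ∀ i, M i ⟶ N i) (i : ℤ) :
    (diskMap φ).f i = biprod.map (φ i) (φ (i - 1)) :=
  rfl

lemma diskInr_diskMap {M N : ℤ → B} (φ : ∀ i, M i ⟶ N i) (i j : ℤ) :
    diskInr M i j ≫ (diskMap φ).f i = φ j ≫ diskInr N i j := by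
  rw [diskMap_f, diskInr, Category.assoc, biprod.inr_map, ← Category.assoc, transport_naturality,
    diskInr, Category.assoc]

lemma ses_diskMap {M N L : ℤ → B} {f : ∀ i, M i ⟶ N i} {g : ∀ i, N i ⟶ L i}
    (h : ∀ i, SES (f i) (g i)) : SES (diskMap f) (diskMap g) := by
  have hi (i : ℤ) : SES ((diskMap f).f i) ((diskMap g).f i) := (h i).biprod_map (h (i - 1))
  exact ⟨HomologicalComplex.hom_ext _ _ fun i => (hi i).1, HomologicalComplex.shortExact_of_degreewise_shortExact _
    fun i => (hi i).2⟩

lemma projective_disk {M : ℤ → B} (hM : ∀ i, Projective (M i)) : Projective (disk M) where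
  factors {E X} f e he := by
    refine ⟨diskDesc fun i j _ => Projective.factorThru (diskInr M i j ≫ f.f i) (e.f i),
      disk_hom_ext fun i j hij => ?_⟩
    rw [HomologicalComplex.comp_f, ← Category.assoc, diskInr_diskDesc _ i j hij,
      Projective.factorThru_comp]

lemma exists_epi_disk {P : ObjectProperty B} (hP : ∀ X, ∃ (Y : B) (f : Y ⟶ X), P Y ∧ Epi f)
    (X : ChainComplex B ℤ) :
    ∃ (M : ℤ → B) (f : disk M ⟶ X), (∀ i, P (M i)) ∧ Epi f := by
  choose Y q hY hq using hP
  let g : ∀ i j, j + 1 = i → (Y (X.X (j + 1)) ⟶ X.X i) := fun i j h => by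
    subst h; exact q _
  have hg : ∀ i j h, Epi (g i j h) := by
    rintro i j rfl; exact hq _
  refine ⟨fun j => Y (X.X (j + 1)), diskDesc g, fun i => hY _, ?_⟩
  refine HomologicalComplex.epi_of_epi_f _ fun i => ?_
  have := hg i (i - 1) (by ring)
  exact epi_of_epi_fac (diskInr_diskDesc g i (i - 1) (by ring))

lemma acyclic_disk (M : ℤ → B) : (disk M).Acyclic := (diskGluing M).acyclic

lemma nonempty_disk_cycles_iso (M : ℤ → B) (i : ℤ) : Nonempty ((disk M).cycles i ≅ M i) :=
  (diskGluing M).nonempty_cycles_iso i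

/-- The sections split each `X i` as cycles in degrees `i` and `i - 1`. -/
lemma nonempty_iso_disk {X : ChainComplex B ℤ} (hX : X.Acyclic)
    (hs : ∀ i j, j + 1 = i → ∃ s : X.cycles j ⟶ X.X i, s ≫ X.toCycles i j = 𝟙 _) :
    Nonempty (X ≅ disk fun i => X.cycles i) := by
  choose s hs using hs
  let φ : (disk fun i => X.cycles i) ⟶ X := diskDesc s
  have hφ (i : ℤ) : φ.f i = biprod.desc (X.iCycles i) (s i (i - 1) (by ring)) := by
    rw [diskDesc_f, ← X.toCycles_i (i + 1) i, ← Category.assoc, hs, Category.id_comp]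
  have (i : ℤ) : IsIso (φ.f i) := by
    rw [hφ]
    exact (ses_cycles hX (by ring)).isIso_desc _ (hs _ _ _)
  have := HomologicalComplex.Hom.isIso_of_components φ
  exact ⟨(asIso φ).symm⟩

lemma nonempty_disk_biprod_iso (M N : ℤ → B) :
    Nonempty (disk (fun i => M i ⊞ N i) ≅ disk M ⊞ disk N) := by
  have h : SES (diskMap fun i => (biprod.inl : M i ⟶ M i ⊞ N i)) (diskMap fun i => biprod.snd) :=
    ses_diskMap fun i => SES.biprod (M i) (N i)
  refine h.nonempty_iso_biprod_of_retraction (diskMap fun i => biprod.fst) ?_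
  refine disk_hom_ext fun i j _ => ?_
  rw [HomologicalComplex.comp_f, ← Category.assoc, diskInr_diskMap, Category.assoc,
    diskInr_diskMap]
  simp

/-- Disks of projective covers are projective covers of disks up to minimality, so dimension
shifting happens degreewise, and extending a map of disks is extending a family of maps. -/
lemma subsingleton_ext_disk [HasExt.{w} B] [HasExt.{w'} (ChainComplex B ℤ)] [EnoughProjectives B]
    {M : ℤ → B} {H : ChainComplex B ℤ}
    (h : ∀ i j, j + 1 = i → ∀ n : ℕ, Subsingleton (Abelian.Ext.{w} (M j) (H.X i) (n + 1)))
    (n : ℕ) : Subsingleton (Abelian.Ext.{w'} (disk M) H (n + 1)) := by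
  have hS (M : ℤ → B) (i : ℤ) : SES (kernel.ι (Projective.π (M i))) (Projective.π (M i)) :=
    SES.of_epi _
  have hL (M : ℤ → B) (n : ℕ) :
      Subsingleton (Abelian.Ext.{w'} (disk fun i => Projective.over (M i)) H (n + 1)) :=
    have := projective_disk (M := fun i => Projective.over (M i)) fun _ => inferInstance
    Abelian.Ext.subsingleton_of_projective _ _ _
  induction n generalizing M with
  | zero =>
    refine (ses_diskMap (hS M)).subsingleton_ext_one (hL M 0) fun k => ?_
    have (i j) (hij : j + 1 = i) :=
      (hS M j).exists_extension (h i j hij 0)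
        (diskInr (fun i => kernel (Projective.π (M i))) i j ≫ k.f i)
    choose l hl using this
    refine ⟨diskDesc l, disk_hom_ext fun i j hij => ?_⟩
    rw [HomologicalComplex.comp_f, ← Category.assoc, diskInr_diskMap, Category.assoc,
      diskInr_diskDesc l i j hij, hl]
  | succ n ih =>
    refine (ses_diskMap (hS M)).subsingleton_ext_right (ih ?_) (hL M (n + 1))
    intro i j hij n
    exact (hS M j).subsingleton_ext_left (Abelian.Ext.subsingleton_of_projective _ _ _)
      (h i j hij (n + 1))

end Disk

end DCProj

namespace DCProj

open Limits ZeroObject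

open scoped TensorProduct

/-! ### Tensor evaluation and biduality for modules. -/

section LinearAlgebra

variable {R : Type u} [CommRing R]
variable {X Y Z : Type u} [AddCommGroup X] [AddCommGroup Y] [AddCommGroup Z] [Module R X]
  [Module R Y] [Module R Z]
variable (N F : Type u) [AddCommGroup N] [AddCommGroup F] [Module R N] [Module R F]

section HomTensor

variable (Z) in
/-- The canonical map `Hom(Z, N) ⊗ F ⟶ Hom(Z, N ⊗ F)`. -/
noncomputable def homTensor : (Z →ₗ[R] N) ⊗[R] F →ₗ[R] Z →ₗ[R] N ⊗[R] F :=
  TensorProduct.rTensorHomToHomRTensor (RingHom.id R) Z N F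

@[simp]
lemma homTensor_tmul (φ : Z →ₗ[R] N) (t : F) (z : Z) :
    homTensor Z N F (φ ⊗ₜ t) z = φ z ⊗ₜ t :=
  rfl

lemma homTensor_naturality (g : Y →ₗ[R] Z) (x : (Z →ₗ[R] N) ⊗[R] F) :
    homTensor Y N F ((LinearMap.lcomp R N g).rTensor F x) = homTensor Z N F x ∘ₗ g := by
  have : homTensor Y N F ∘ₗ (LinearMap.lcomp R N g).rTensor F =
      LinearMap.lcomp R (N ⊗[R] F) g ∘ₗ homTensor Z N F := by
    ext; simp
  exact LinearMap.congr_fun this x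

lemma homTensor_bijective_of_projective [Module.Finite R Z] [Module.Projective R Z] :
    Function.Bijective (homTensor (R := R) Z N F) := by
  have h := rTensorHomEquivHomRTensor_toLinearMap (R := R) (M := Z) (P := N) (Q := F)
  rw [homTensor, ← h]
  exact (rTensorHomEquivHomRTensor R Z N F).bijective

variable {f : X →ₗ[R] Y} {g : Y →ₗ[R] Z}

lemma homTensor_injective [Module.Flat R F] (hg : Function.Surjective g)
    (hY : Function.Bijective (homTensor (R := R) Y N F)) :
    Function.Injective (homTensor (R := R) Z N F) := by
  intro x y hxy
  have h : Function.Injective (LinearMap.lcomp R N g) := fun φ ψ h =>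
    (LinearMap.cancel_right hg).1 h
  apply Module.Flat.rTensor_preserves_injective_linearMap (M := F) _ h
  apply hY.1
  rw [homTensor_naturality, homTensor_naturality, hxy]

/-- A five-lemma argument: flatness of `F` keeps `Hom(-, N) ⊗ F` left exact. -/
lemma homTensor_bijective [Module.Flat R F] (hfg : Function.Exact f g) (hg : Function.Surjective g)
    (hY : Function.Bijective (homTensor (R := R) Y N F))
    (hX : Function.Injective (homTensor (R := R) X N F)) :
    Function.Bijective (homTensor (R := R) Z N F) := by
  refine ⟨homTensor_injective N F hg hY, fun φ => ?_⟩
  obtain ⟨x, hx⟩ := hY.2 (φ ∘ₗ g)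
  have hx' : (LinearMap.lcomp R N f).rTensor F x = 0 := by
    apply hX
    rw [homTensor_naturality, hx, map_zero, LinearMap.comp_assoc, hfg.linearMap_comp_eq_zero,
      LinearMap.comp_zero]
  obtain ⟨y, rfl⟩ := (Module.Flat.rTensor_exact F
    (LinearMap.exact_lcomp_of_exact_of_surjective N hfg hg) x).1 hx'
  refine ⟨y, (LinearMap.cancel_right hg).1 ?_⟩
  rw [← homTensor_naturality, hx]

end HomTensor

section Bidual

variable (Z) in
/-- The canonical map `Z ⊗ F ⟶ Hom(Hom(Z, N), N ⊗ F)`. -/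
noncomputable def tensorBidual : Z ⊗[R] F →ₗ[R] (Z →ₗ[R] N) →ₗ[R] N ⊗[R] F :=
  homTensor (Z →ₗ[R] N) N F ∘ₗ (LinearMap.applyₗ (R := R) (M := Z) (M₂ := N)).rTensor F

@[simp]
lemma tensorBidual_tmul (z : Z) (t : F) (φ : Z →ₗ[R] N) :
    tensorBidual Z N F (z ⊗ₜ t) φ = φ z ⊗ₜ t :=
  rfl

lemma tensorBidual_naturality (g : Y →ₗ[R] Z) (x : Y ⊗[R] F) :
    tensorBidual Z N F (g.rTensor F x) = tensorBidual Y N F x ∘ₗ LinearMap.lcomp R N g := by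
  have : tensorBidual Z N F ∘ₗ g.rTensor F =
      LinearMap.lcomp R (N ⊗[R] F) (LinearMap.lcomp R N g) ∘ₗ tensorBidual Y N F := by
    ext; simp
  exact LinearMap.congr_fun this x

/-- A module with a finite family of maps `a i` to `Y` and `b i` from `Y` with `∑ i, b i ∘ a i = 1`
inherits bijectivity of `tensorBidual` from `Y`. -/
lemma tensorBidual_bijective_of_sum {ι : Type*} [Fintype ι] (a : ι → Z →ₗ[R] Y)
    (b : ι → Y →ₗ[R] Z) (hab : ∑ i, b i ∘ₗ a i = LinearMap.id)
    (hY : Function.Bijective (tensorBidual (R := R) Y N F)) :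
    Function.Bijective (tensorBidual (R := R) Z N F) := by
  constructor
  · rw [← LinearMap.ker_eq_bot, LinearMap.ker_eq_bot']
    intro x hx
    have h (i) : (a i).rTensor F x = 0 := by
      apply hY.1
      rw [tensorBidual_naturality, hx, map_zero, LinearMap.zero_comp]
    have h' : x = ∑ i, (b i).rTensor F ((a i).rTensor F x) := by
      have : ∑ i, (b i).rTensor F ∘ₗ (a i).rTensor F = LinearMap.id := by
        refine TensorProduct.ext' fun z t => ?_
        have hz : ∑ i, b i (a i z) = z := by simpa using LinearMap.congr_fun hab z
        simp [← TensorProduct.sum_tmul, hz]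
      simpa using (LinearMap.congr_fun this x).symm
    rw [h']
    simp [h]
  · intro φ
    choose x hx using fun i => hY.2 (φ ∘ₗ LinearMap.lcomp R N (a i))
    refine ⟨∑ i, (b i).rTensor F (x i), ?_⟩
    simp only [map_sum, tensorBidual_naturality, hx]
    ext ψ
    have : ψ = ∑ i, LinearMap.lcomp R N (a i) (LinearMap.lcomp R N (b i) ψ) := by
      ext z
      have hz : ∑ i, b i (a i z) = z := by simpa using LinearMap.congr_fun hab z
      simp [LinearMap.sum_apply, ← map_sum, hz]
    conv_rhs => rw [this, map_sum]
    simp only [LinearMap.sum_apply, LinearMap.comp_apply]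

lemma tensorBidual_bijective_of_projective [Module.Finite R Z] [Module.Projective R Z]
    (hR : Function.Bijective (tensorBidual (R := R) R N F)) :
    Function.Bijective (tensorBidual (R := R) Z N F) := by
  obtain ⟨n, f, g, -, -, hfg⟩ := Module.Finite.exists_comp_eq_id_of_projective R Z
  refine tensorBidual_bijective_of_sum N F (fun i => LinearMap.proj i ∘ₗ g)
    (fun i => f ∘ₗ LinearMap.single R (fun _ : Fin n => R) i) ?_ hR
  rw [← hfg]
  ext z
  simp only [LinearMap.sum_apply, LinearMap.comp_apply, ← map_sum]
  congr 1
  ext j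
  simp [Finset.sum_apply, Pi.single_apply]

/-- Under `Hom(R, N) = N` and `R = Hom(N, N)`, biduality for `R` becomes `homTensor` for `N`. -/
lemma tensorBidual_self_bijective (hN : Function.Bijective (LinearMap.lsmul R N))
    (h : Function.Bijective (homTensor (R := R) N N F)) :
    Function.Bijective (tensorBidual (R := R) R N F) := by
  let e : N ≃ₗ[R] (R →ₗ[R] N) := (LinearMap.ringLmapEquivSelf R R N).symm
  let l : R ≃ₗ[R] (N →ₗ[R] N) := LinearEquiv.ofBijective (LinearMap.lsmul R N) hN
  have key : LinearMap.lcomp R (N ⊗[R] F) e.toLinearMap ∘ₗ tensorBidual R N F =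
      homTensor N N F ∘ₗ l.toLinearMap.rTensor F := by
    ext t c
    simp [e, l, LinearMap.lcomp]
  have h₁ : Function.Bijective (homTensor N N F ∘ₗ l.toLinearMap.rTensor F) :=
    h.comp (LinearEquiv.rTensor F l).bijective
  rw [← key] at h₁
  have h₂ : Function.Bijective (LinearMap.lcomp R (N ⊗[R] F) e.toLinearMap) :=
    (LinearEquiv.congrLeft (N ⊗[R] F) R e.symm).bijective
  exact (Function.Bijective.of_comp_iff' h₂ _).1 h₁

/-- `Hom(N, N)` is generated by the identity, so evaluation there is the inverse. -/
lemma tensorBidual_bijective_of_homothety (hN : Function.Bijective (LinearMap.lsmul R N)) :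
    Function.Bijective (tensorBidual (R := R) N N F) := by
  have hinj : ∀ φ ψ : (N →ₗ[R] N) →ₗ[R] N ⊗[R] F, φ LinearMap.id = ψ LinearMap.id → φ = ψ := by
    intro φ ψ h
    ext k
    obtain ⟨r, rfl⟩ := hN.2 k
    have : LinearMap.lsmul R N r = r • LinearMap.id := by ext; simp
    rw [this, map_smul, map_smul, h]
  have hid (x : N ⊗[R] F) : tensorBidual N N F x LinearMap.id = x := by
    have : LinearMap.applyₗ LinearMap.id ∘ₗ tensorBidual N N F =
        (LinearMap.id : N ⊗[R] F →ₗ[R] N ⊗[R] F) := by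
      ext; simp
    exact LinearMap.congr_fun this x
  refine ⟨fun x y h => ?_, fun φ => ⟨φ LinearMap.id, hinj _ _ (hid _)⟩⟩
  rw [← hid x, h, hid]

variable {f : X →ₗ[R] Y} {g : Y →ₗ[R] Z}

lemma tensorBidual_bijective_left [Module.Flat R F] (hf : Function.Injective f)
    (hfg : Function.Exact f g) (hg : Function.Surjective g)
    (hN : Function.Surjective (LinearMap.lcomp R N f))
    (hY : Function.Bijective (tensorBidual (R := R) Y N F))
    (hZ : Function.Injective (tensorBidual (R := R) Z N F)) :
    Function.Bijective (tensorBidual (R := R) X N F) := by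
  constructor
  · intro x y hxy
    apply Module.Flat.rTensor_preserves_injective_linearMap (M := F) f hf
    apply hY.1
    rw [tensorBidual_naturality, tensorBidual_naturality, hxy]
  · intro φ
    obtain ⟨x, hx⟩ := hY.2 (φ ∘ₗ LinearMap.lcomp R N f)
    have hx' : g.rTensor F x = 0 := by
      apply hZ
      rw [tensorBidual_naturality, hx, map_zero]
      ext ψ
      have : (ψ ∘ₗ g) ∘ₗ f = 0 := by
        rw [LinearMap.comp_assoc, hfg.linearMap_comp_eq_zero, LinearMap.comp_zero]
      simp [LinearMap.lcomp_apply', this]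
    obtain ⟨y, rfl⟩ := (rTensor_exact F hfg hg x).1 hx'
    refine ⟨y, (LinearMap.cancel_right hN).1 ?_⟩
    rw [← tensorBidual_naturality, hx]

/-- By biduality `k` is evaluation at an element of `Z ⊗ F`, which lifts to `Y ⊗ F`. This kills Ext¹
of the dual of a syzygy. -/
lemma exists_comp_lcomp_eq (hg : Function.Surjective g)
    (hZ : Function.Surjective (tensorBidual (R := R) Z N F))
    (k : (Z →ₗ[R] N) →ₗ[R] N ⊗[R] F) :
    ∃ l : (Y →ₗ[R] N) →ₗ[R] N ⊗[R] F, l ∘ₗ LinearMap.lcomp R N g = k := by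
  obtain ⟨x, rfl⟩ := hZ k
  obtain ⟨y, rfl⟩ := LinearMap.rTensor_surjective F hg x
  exact ⟨tensorBidual Y N F y, (tensorBidual_naturality N F g y).symm⟩

end Bidual

/-- By adjunction, a lifting problem for `P` along `Hom(Y, N) ⟶ Hom(X, N)`. -/
lemma exists_comp_eq_of_lcomp_surjective {f : X →ₗ[R] Y} (P : Type u) [AddCommGroup P] [Module R P]
    [Module.Projective R P] (hf : Function.Surjective (LinearMap.lcomp R N f))
    (k : X ⊗[R] P →ₗ[R] N) : ∃ l : Y ⊗[R] P →ₗ[R] N, l ∘ₗ f.rTensor P = k := by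
  obtain ⟨h, hh⟩ := Module.projective_lifting_property (LinearMap.lcomp R N f)
    (TensorProduct.curry k).flip hf
  refine ⟨TensorProduct.lift h.flip, TensorProduct.ext' fun x p => ?_⟩
  simpa using LinearMap.congr_fun (LinearMap.congr_fun hh p) x

end LinearAlgebra

end DCProj

namespace DCProj

open Limits ZeroObject

open scoped TensorProduct

variable {R : Type u} [CommRing R]

/-! ### Short exact sequences of modules under Hom and tensor. -/

section SES

lemma ses_ofHom {X Y Z : Type u} [AddCommGroup X] [AddCommGroup Y] [AddCommGroup Z] [Module R X]
    [Module R Y] [Module R Z] {f : X →ₗ[R] Y} {g : Y →ₗ[R] Z} (hf : Function.Injective f)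
    (hfg : Function.Exact f g) (hg : Function.Surjective g) :
    SES (ModuleCat.ofHom f) (ModuleCat.ofHom g) := by
  have : Mono (ModuleCat.ofHom f) := (ModuleCat.mono_iff_injective _).2 hf
  have : Epi (ModuleCat.ofHom g) := (ModuleCat.epi_iff_surjective _).2 hg
  have w : ModuleCat.ofHom f ≫ ModuleCat.ofHom g = 0 := by
    rw [← ModuleCat.ofHom_comp, hfg.linearMap_comp_eq_zero]; rfl
  exact ⟨w, ShortComplex.ShortExact.mk
    ((ShortComplex.ShortExact.moduleCat_exact_iff_function_exact _).2 hfg)⟩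

variable {X Y Z : ModuleCat.{u} R} {f : X ⟶ Y} {g : Y ⟶ Z}

namespace SES

lemma injective (h : SES f g) : Function.Injective f.hom :=
  (ModuleCat.mono_iff_injective f).1 h.mono

lemma surjective (h : SES f g) : Function.Surjective g.hom :=
  (ModuleCat.epi_iff_surjective g).1 h.epi

lemma exact (h : SES f g) : Function.Exact f.hom g.hom :=
  (ShortComplex.ShortExact.moduleCat_exact_iff_function_exact _).1 h.2.exact

lemma lcomp_surjective (h : SES f g) {N : ModuleCat.{u} R}
    (hN : Subsingleton (Abelian.Ext.{u} Z N 1)) :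
    Function.Surjective (LinearMap.lcomp R N f.hom) := fun k => by
  obtain ⟨l, hl⟩ := h.exists_extension hN (ModuleCat.ofHom k)
  exact ⟨l.hom, congrArg ModuleCat.Hom.hom hl⟩

lemma ses_lcomp (h : SES f g) {N : ModuleCat.{u} R}
    (hN : Subsingleton (Abelian.Ext.{u} Z N 1)) :
    SES (ModuleCat.ofHom (LinearMap.lcomp R N g.hom))
      (ModuleCat.ofHom (LinearMap.lcomp R N f.hom)) :=
  ses_ofHom (fun _ _ hφ => (LinearMap.cancel_right h.surjective).1 hφ)
    (LinearMap.exact_lcomp_of_exact_of_surjective N h.exact h.surjective) (h.lcomp_surjective hN)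

lemma ses_rTensor {X Y Z : Type u} [AddCommGroup X] [AddCommGroup Y] [AddCommGroup Z] [Module R X]
    [Module R Y] [Module R Z] {f : X →ₗ[R] Y} {g : Y →ₗ[R] Z}
    (h : SES (ModuleCat.ofHom f) (ModuleCat.ofHom g)) (F : Type u) [AddCommGroup F] [Module R F]
    [Module.Flat R F] : SES (ModuleCat.ofHom (f.rTensor F)) (ModuleCat.ofHom (g.rTensor F)) :=
  ses_ofHom (Module.Flat.rTensor_preserves_injective_linearMap _ h.injective)
    (rTensor_exact F h.exact h.surjective) (LinearMap.rTensor_surjective F h.surjective)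

end SES

end SES

/-! ### Modules without higher extensions. -/

section NoExt

/-- All higher extension groups of `M` by `N` vanish. -/
def NoExt (M N : ModuleCat.{u} R) : Prop :=
  ∀ n : ℕ, Subsingleton (Abelian.Ext.{u} M N (n + 1))

lemma NoExt.congr_left {M M' N : ModuleCat.{u} R} (h : NoExt M N) (e : M ≃ₗ[R] M') :
    NoExt M' N :=
  fun n => subsingleton_ext_of_iso e.toModuleIso (h n)

lemma NoExt.congr_right {M N N' : ModuleCat.{u} R} (h : NoExt M N) (e : N ≃ₗ[R] N') :
    NoExt M N' := fun n => by
  have := h n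
  refine subsingleton_of_forall_eq 0 fun x => ?_
  have hx : x = (x.comp (Abelian.Ext.mk₀ e.toModuleIso.inv) (add_zero _)).comp
      (Abelian.Ext.mk₀ e.toModuleIso.hom) (add_zero _) := by
    rw [Abelian.Ext.comp_assoc_of_third_deg_zero, Abelian.Ext.mk₀_comp_mk₀, Iso.inv_hom_id,
      Abelian.Ext.comp_mk₀_id]
  rw [hx, Subsingleton.elim (x.comp (Abelian.Ext.mk₀ e.toModuleIso.inv) (add_zero _)) 0,
    Abelian.Ext.zero_comp]

lemma noExt_of_projective (M N : ModuleCat.{u} R) [Module.Projective R M] : NoExt M N := fun _ =>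
  have : Projective M := (IsProjective.iff_projective M).1 inferInstance
  Abelian.Ext.subsingleton_of_projective _ _ _

variable {X Y Z : ModuleCat.{u} R} {f : X ⟶ Y} {g : Y ⟶ Z}

lemma SES.noExt_left (h : SES f g) {N : ModuleCat.{u} R} (hY : NoExt Y N) (hZ : NoExt Z N) :
    NoExt X N :=
  fun n => h.subsingleton_ext_left (hY n) (hZ (n + 1))

lemma SES.noExt_right (h : SES f g) {N : ModuleCat.{u} R} (hX : NoExt X N) (hY : NoExt Y N)
    (hf : Function.Surjective (LinearMap.lcomp R N f.hom)) : NoExt Z N := fun n => by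
  cases n with
  | zero =>
    refine h.subsingleton_ext_one (hY 0) fun k => ?_
    obtain ⟨l, hl⟩ := hf k.hom
    exact ⟨ModuleCat.ofHom l, ModuleCat.hom_ext hl⟩
  | succ n => exact h.subsingleton_ext_right (hX n) (hY (n + 1))

lemma exists_ses_projective (M : ModuleCat.{u} R) :
    ∃ (K L : ModuleCat.{u} R) (f : K ⟶ L) (g : L ⟶ M), SES f g ∧ Module.Projective R L :=
  ⟨_, _, _, _, SES.of_epi (Projective.π M),
    (IsProjective.iff_projective _).2 (Projective.projective_over M)⟩

lemma NoExt.tensor_projective {M N : ModuleCat.{u} R} (h : NoExt M N) (P : Type u) [AddCommGroup P]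
    [Module R P] [Module.Projective R P] : NoExt (ModuleCat.of R (M ⊗[R] P)) N := by
  intro n
  induction n generalizing M with
  | zero =>
    obtain ⟨K, L, f, g, hfg, hL⟩ := exists_ses_projective M
    have hT := SES.ses_rTensor (f := f.hom) (g := g.hom) hfg P
    refine hT.subsingleton_ext_one (noExt_of_projective _ _ 0) fun k => ?_
    obtain ⟨l, hl⟩ := exists_comp_eq_of_lcomp_surjective N P (hfg.lcomp_surjective (h 0)) k.hom
    exact ⟨ModuleCat.ofHom l, ModuleCat.hom_ext hl⟩
  | succ n ih =>
    obtain ⟨K, L, f, g, hfg, hL⟩ := exists_ses_projective M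
    have hT := SES.ses_rTensor (f := f.hom) (g := g.hom) hfg P
    exact hT.subsingleton_ext_right (ih (hfg.noExt_left (noExt_of_projective _ _) h))
      (noExt_of_projective _ _ (n + 1))

end NoExt

/-! ### Semidualizing modules: Ext vanishing and `C`-projective coresolutions. -/

section Semidualizing

/-- The class of finitely generated projective modules. -/
def fgProj (R : Type u) [CommRing R] : ObjectProperty (ModuleCat.{u} R) :=
  fun M => Module.Finite R M ∧ Module.Projective R M

lemma homTensor_bijective_of_seqRes {Z : ModuleCat.{u} R} (hZ : SeqRes (fun _ => fgProj R) Z)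
    (N F : Type u) [AddCommGroup N] [AddCommGroup F] [Module R N] [Module R F] [Module.Flat R F] :
    Function.Bijective (homTensor (R := R) Z N F) := by
  obtain ⟨X, Y, f, g, hfg, ⟨_, _⟩, hX⟩ := hZ.uncons
  obtain ⟨W, Y', f', g', hfg', ⟨_, _⟩, -⟩ := hX.uncons
  exact homTensor_bijective N F hfg.exact hfg.surjective (homTensor_bijective_of_projective N F)
    (homTensor_injective N F hfg'.surjective (homTensor_bijective_of_projective N F))

lemma noExt_tensor_of_seqRes {Z : ModuleCat.{u} R} (hZ : SeqRes (fun _ => fgProj R) Z)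
    {N : ModuleCat.{u} R} (h : NoExt Z N) (F : Type u) [AddCommGroup F] [Module R F]
    [Module.Flat R F] : NoExt Z (ModuleCat.of R (N ⊗[R] F)) := by
  have step {Z : ModuleCat.{u} R} (hZ : SeqRes (fun _ => fgProj R) Z) (h : NoExt Z N) :
      ∃ (X Y : ModuleCat.{u} R) (f : X ⟶ Y) (g : Y ⟶ Z), SES f g ∧ Module.Projective R Y ∧
        SeqRes (fun _ => fgProj R) X ∧ NoExt X N ∧
        Function.Surjective (LinearMap.lcomp R (N ⊗[R] F) f.hom) := by
    obtain ⟨X, Y, f, g, hfg, ⟨_, _⟩, hX⟩ := hZ.uncons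
    refine ⟨X, Y, f, g, hfg, inferInstance, hX, hfg.noExt_left (noExt_of_projective _ _) h, ?_⟩
    intro k
    -- `k` comes from `Hom(X, N) ⊗ F`, onto which `Hom(Y, N) ⊗ F` maps since `Ext¹(Z, N) = 0`.
    obtain ⟨x, rfl⟩ := (homTensor_bijective_of_seqRes hX N F).2 k
    obtain ⟨y, rfl⟩ := LinearMap.rTensor_surjective F (hfg.lcomp_surjective (h 0)) x
    exact ⟨homTensor Y N F y, (homTensor_naturality N F f.hom y).symm⟩
  intro n
  induction n generalizing Z with
  | zero =>
    obtain ⟨X, Y, f, g, hfg, hY, -, -, hf⟩ := step hZ h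
    refine hfg.subsingleton_ext_one (noExt_of_projective Y _ 0) fun k => ?_
    obtain ⟨l, hl⟩ := hf k.hom
    exact ⟨ModuleCat.ofHom l, ModuleCat.hom_ext hl⟩
  | succ n ih =>
    obtain ⟨X, Y, f, g, hfg, hY, hX, hXN, -⟩ := step hZ h
    exact hfg.subsingleton_ext_right (ih hX hXN) (noExt_of_projective Y _ (n + 1))

variable {C : ModuleCat.{u} R}

lemma IsSemidualizing.seqRes (hC : IsSemidualizing C) : SeqRes (fun _ => fgProj R) C := by
  obtain ⟨P, hP⟩ := hC.resolution
  exact ⟨{ G := P.complex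
           ε := P.π.f 0
           w := P.complex_d_comp_π_f_zero
           epi_ε := inferInstanceAs (Epi (P.π.f 0))
           exact_zero := P.exact₀
           exact_succ := P.complex_exactAt_succ },
    fun i => ⟨hP i, (IsProjective.iff_projective _).2 (P.projective i)⟩⟩

lemma IsSemidualizing.noExt_self (hC : IsSemidualizing C) : NoExt C C :=
  fun n => hC.ext_eq_zero (n + 1) (by lia)

lemma IsSemidualizing.noExt_tensor (hC : IsSemidualizing C) (P F : Type u) [AddCommGroup P]
    [Module R P] [Module.Projective R P] [AddCommGroup F] [Module R F] [Module.Flat R F] :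
    NoExt (ModuleCat.of R (C ⊗[R] P)) (ModuleCat.of R (C ⊗[R] F)) :=
  (noExt_tensor_of_seqRes hC.seqRes hC.noExt_self F).tensor_projective P

lemma IsSemidualizing.noExt (hC : IsSemidualizing C) {M N : ModuleCat.{u} R} (hM : cProjMod C M)
    (hN : cFlatMod C N) : NoExt M N := by
  obtain ⟨P, _, ⟨e⟩⟩ := hM
  obtain ⟨F, _, ⟨e'⟩⟩ := hN
  exact ((hC.noExt_tensor P F).congr_left (M' := M) e.symm).congr_right (N' := N) e'.symm

lemma cProjMod_hom_tensor (C : ModuleCat.{u} R) (Y P : Type u) [AddCommGroup Y] [Module R Y]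
    [Module.Finite R Y] [Module.Projective R Y] [AddCommGroup P] [Module R P]
    [Module.Projective R P] : cProjMod C (ModuleCat.of R ((Y →ₗ[R] C) ⊗[R] P)) := by
  refine ⟨ModuleCat.of R (Module.Dual R Y ⊗[R] P), inferInstance, ⟨?_⟩⟩
  exact TensorProduct.congr ((dualTensorHomEquiv R Y C).symm ≪≫ₗ TensorProduct.comm R _ _)
    (LinearEquiv.refl R P) ≪≫ₗ TensorProduct.assoc R C (Module.Dual R Y) P

/-- Modules with a degreewise finite projective resolution that are well behaved with respect to
the duality `Hom(-, C)`. -/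
structure IsDualizable (C Z : ModuleCat.{u} R) : Prop where
  seqRes : SeqRes (fun _ => fgProj R) Z
  noExt : NoExt Z C
  bidual : ∀ (F : Type u) [AddCommGroup F] [Module R F] [Module.Flat R F],
    Function.Bijective (tensorBidual (R := R) Z C F)
  noExt_dual : ∀ (F : Type u) [AddCommGroup F] [Module R F] [Module.Flat R F],
    NoExt (ModuleCat.of R (Z →ₗ[R] C)) (ModuleCat.of R (C ⊗[R] F))

lemma IsSemidualizing.isDualizable (hC : IsSemidualizing C) : IsDualizable C C where
  seqRes := hC.seqRes
  noExt := hC.noExt_self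
  bidual _ _ _ _ := tensorBidual_bijective_of_homothety C _ hC.homothety
  noExt_dual _ _ _ _ :=
    (noExt_of_projective (ModuleCat.of R R) _).congr_left (M' := ModuleCat.of R (C →ₗ[R] C))
      (LinearEquiv.ofBijective _ hC.homothety)

lemma IsSemidualizing.noExt_hom (hC : IsSemidualizing C) (Y F : Type u) [AddCommGroup Y]
    [Module R Y] [Module.Finite R Y] [Module.Projective R Y] [AddCommGroup F] [Module R F]
    [Module.Flat R F] : NoExt (ModuleCat.of R (Y →ₗ[R] C)) (ModuleCat.of R (C ⊗[R] F)) :=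
  (hC.noExt_tensor (Module.Dual R Y) F).congr_left (M' := ModuleCat.of R (Y →ₗ[R] C))
    (TensorProduct.comm R _ _ ≪≫ₗ dualTensorHomEquiv R Y C)

/-- Syzygies inherit dualizability: biduality passes to `X` by the five lemma, and biduality for `Z`
gives the Ext¹ vanishing for `Hom(X, C)`. -/
lemma IsSemidualizing.exists_ses_of_isDualizable (hC : IsSemidualizing C) {Z : ModuleCat.{u} R}
    (hZ : IsDualizable C Z) : ∃ (X Y : ModuleCat.{u} R) (f : X ⟶ Y) (g : Y ⟶ Z),
      SES f g ∧ fgProj R Y ∧ IsDualizable C X := by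
  obtain ⟨X, Y, f, g, hfg, ⟨hY₁, hY₂⟩, hX⟩ := hZ.seqRes.uncons
  have hY (F : Type u) [AddCommGroup F] [Module R F] [Module.Flat R F] :
      Function.Bijective (tensorBidual (R := R) Y C F) :=
    tensorBidual_bijective_of_projective C F (tensorBidual_self_bijective C F hC.homothety
      (homTensor_bijective_of_seqRes hC.seqRes C F))
  refine ⟨X, Y, f, g, hfg, ⟨hY₁, hY₂⟩, hX, hfg.noExt_left (noExt_of_projective _ _) hZ.noExt,
    fun F _ _ _ => ?_, fun F _ _ _ => ?_⟩
  · exact tensorBidual_bijective_left C F hfg.injective hfg.exact hfg.surjective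
      (hfg.lcomp_surjective (hZ.noExt 0)) (hY F) (hZ.bidual F).1
  · exact (hfg.ses_lcomp (hZ.noExt 0)).noExt_right (hZ.noExt_dual F) (hC.noExt_hom Y F)
      (exists_comp_lcomp_eq C F hfg.surjective (hZ.bidual F).2)

/-- The class of modules `Hom(Z, C) ⊗ P` with `Z` dualizable and `P` projective. -/
def dualTensorMod (C : ModuleCat.{u} R) : ObjectProperty (ModuleCat.{u} R) :=
  fun M => ∃ Z P : ModuleCat.{u} R, IsDualizable C Z ∧ Module.Projective R P ∧
    Nonempty (M ≃ₗ[R] (Z →ₗ[R] C) ⊗[R] P)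

lemma noExt_of_dualTensorMod {M N : ModuleCat.{u} R} (hM : dualTensorMod C M)
    (hN : cFlatMod C N) : NoExt M N := by
  obtain ⟨Z, P, hZ, _, ⟨e⟩⟩ := hM
  obtain ⟨F, _, ⟨e'⟩⟩ := hN
  exact (((hZ.noExt_dual F).tensor_projective P).congr_left (M' := M) e.symm).congr_right
    (N' := N) e'.symm

lemma IsSemidualizing.exists_ses_of_dualTensorMod (hC : IsSemidualizing C) {M : ModuleCat.{u} R}
    (hM : dualTensorMod C M) : ∃ (N L : ModuleCat.{u} R) (f : M ⟶ N) (g : N ⟶ L),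
      SES f g ∧ cProjMod C N ∧ dualTensorMod C L := by
  obtain ⟨Z, P, hZ, _, ⟨e⟩⟩ := hM
  obtain ⟨X, Y, f, g, hfg, ⟨_, _⟩, hX⟩ := hC.exists_ses_of_isDualizable hZ
  have h := (hfg.ses_lcomp (hZ.noExt 0)).ses_rTensor P
  exact ⟨_, _, _, _, h.congr_left (X' := M) e.toModuleIso, cProjMod_hom_tensor C Y P,
    X, P, hX, inferInstance, ⟨LinearEquiv.refl _ _⟩⟩

lemma IsSemidualizing.dualTensorMod_of_projective (hC : IsSemidualizing C) (M : ModuleCat.{u} R)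
    [Module.Projective R M] : dualTensorMod C M :=
  ⟨C, M, hC.isDualizable, inferInstance,
    ⟨(TensorProduct.lid R M).symm ≪≫ₗ
      TensorProduct.congr (LinearEquiv.ofBijective _ hC.homothety) (LinearEquiv.refl R M)⟩⟩

end Semidualizing

end DCProj

namespace DCProj

open Limits ZeroObject

open scoped TensorProduct

variable {R : Type u} [CommRing R]

/-! ### Complexes with prescribed cycles as sums of disks. -/

section Tilde

variable {P : ObjectProperty (ModuleCat.{u} R)}

instance [P.IsClosedUnderIsomorphisms] : (tilde P).IsClosedUnderIsomorphisms where
  of_iso {X Y} e hX := by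
    refine ⟨fun i => HomologicalComplex.ExactAt.of_iso (hX.1 i) e, fun i => ?_⟩
    exact P.prop_of_iso ((HomologicalComplex.cyclesFunctor _ _ i).mapIso e) (hX.2 i)

lemma tilde_disk [P.IsClosedUnderIsomorphisms] {M : ℤ → ModuleCat.{u} R} (hM : ∀ i, P (M i)) :
    tilde P (disk M) :=
  ⟨acyclic_disk M, fun i => P.prop_of_iso (nonempty_disk_cycles_iso M i).some.symm (hM i)⟩

lemma exists_iso_disk {X : Ch R} (hX : tilde P X)
    (hP : ∀ M N, P M → P N → Subsingleton (Abelian.Ext.{u} M N 1)) :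
    ∃ M : ℤ → ModuleCat.{u} R, (∀ i, P (M i)) ∧ Nonempty (X ≅ disk M) := by
  refine ⟨fun i => X.cycles i, hX.2, nonempty_iso_disk hX.1 fun i j hij => ?_⟩
  have h := ses_cycles hX.1 hij
  obtain ⟨r, hr⟩ := h.exists_extension (hP _ _ (hX.2 j) (hX.2 i)) (𝟙 _)
  -- The idempotent complementary to the retraction kills the cycles, so it descends to a section.
  obtain ⟨s, hs⟩ := h.exists_desc (𝟙 _ - r ≫ X.iCycles i) (by
    rw [Preadditive.comp_sub, reassoc_of% hr, Category.comp_id, sub_self])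
  have := h.epi
  refine ⟨s, ?_⟩
  rw [← cancel_epi (X.toCycles i j), reassoc_of% hs, Preadditive.sub_comp, Category.assoc, h.zero,
    comp_zero, sub_zero, Category.id_comp, Category.comp_id]

lemma tilde_mono {P Q : ObjectProperty (ModuleCat.{u} R)} (h : ∀ M, P M → Q M) {X : Ch R}
    (hX : tilde P X) : tilde Q X :=
  ⟨hX.1, fun i => h _ (hX.2 i)⟩

lemma tilde_of_isZero (hP : ∀ M, IsZero M → P M) {X : Ch R} (hX : IsZero X) : tilde P X := by
  have h (i : ℤ) : IsZero (X.X i) := (HomologicalComplex.eval _ _ i).map_isZero hX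
  exact ⟨fun i => ShortComplex.exact_of_isZero_X₂ _ (h i),
    fun i => hP _ ((h i).of_mono (X.iCycles i))⟩

lemma tilde_biprod [P.IsClosedUnderIsomorphisms]
    (hP : ∀ M N, P M → P N → Subsingleton (Abelian.Ext.{u} M N 1))
    (hP' : ∀ M N, P M → P N → P (M ⊞ N)) {X Y : Ch R} (hX : tilde P X) (hY : tilde P Y) :
    tilde P (X ⊞ Y) := by
  obtain ⟨M, hM, ⟨e⟩⟩ := exists_iso_disk hX hP
  obtain ⟨N, hN, ⟨e'⟩⟩ := exists_iso_disk hY hP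
  exact (tilde P).prop_of_iso ((nonempty_disk_biprod_iso M N).some ≪≫ (biprod.mapIso e e').symm)
    (tilde_disk fun i => hP' _ _ (hM i) (hN i))

lemma exists_epi_of_tilde [P.IsClosedUnderIsomorphisms]
    (hP : ∀ M, ∃ (N : ModuleCat.{u} R) (f : N ⟶ M), P N ∧ Epi f) (X : Ch R) :
    ∃ (Y : Ch R) (f : Y ⟶ X), tilde P Y ∧ Epi f := by
  obtain ⟨M, f, hM, hf⟩ := exists_epi_disk hP X
  exact ⟨_, f, tilde_disk hM, hf⟩

/-- The higher extension groups of a sum of disks by an exact complex vanish if those of the terms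
by the cycles do. -/
lemma subsingleton_ext_disk_of_cycles {M : ℤ → ModuleCat.{u} R} {H : Ch R} (hH : H.Acyclic)
    (h : ∀ i j, NoExt (M i) (H.cycles j)) (n : ℕ) :
    Subsingleton (Abelian.Ext.{u} (disk M) H (n + 1)) :=
  subsingleton_ext_disk (fun i j hij n => (ses_cycles hH hij).subsingleton_ext_covariant_mid
    (h j i n) (h j j n)) n

end Tilde

/-! ### Admissibility of the classes of complexes, and the theorem. -/

section Classes

instance : (projMod R).IsClosedUnderIsomorphisms where
  of_iso e := fun (_ : Module.Projective R _) => Module.Projective.of_equiv e.toLinearEquiv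

instance (C : ModuleCat.{u} R) : (cProjMod C).IsClosedUnderIsomorphisms where
  of_iso e := fun ⟨P, hP, ⟨e'⟩⟩ => ⟨P, hP, ⟨e.toLinearEquiv.symm ≪≫ₗ e'⟩⟩

instance (C : ModuleCat.{u} R) : (cFlatMod C).IsClosedUnderIsomorphisms where
  of_iso e := fun ⟨P, hP, ⟨e'⟩⟩ => ⟨P, hP, ⟨e.toLinearEquiv.symm ≪≫ₗ e'⟩⟩

lemma cFlatMod_of_cProjMod {C M : ModuleCat.{u} R} (h : cProjMod C M) : cFlatMod C M := by
  obtain ⟨P, _, e⟩ := h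
  exact ⟨P, inferInstance, e⟩

lemma cProjMod_of_isZero (C : ModuleCat.{u} R) {M : ModuleCat.{u} R} (hM : IsZero M) :
    cProjMod C M := by
  have := ModuleCat.subsingleton_of_isZero hM
  exact ⟨ModuleCat.of R PUnit, inferInstance, ⟨0, 0, fun _ => Subsingleton.elim _ _,
    fun _ => Subsingleton.elim _ _⟩⟩

lemma cProjMod_biprod {C M N : ModuleCat.{u} R} (hM : cProjMod C M) (hN : cProjMod C N) :
    cProjMod C (M ⊞ N) := by
  obtain ⟨P, _, ⟨e⟩⟩ := hM
  obtain ⟨Q, _, ⟨e'⟩⟩ := hN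
  exact ⟨ModuleCat.of R (P × Q), inferInstance, ⟨(ModuleCat.biprodIsoProd M N).toLinearEquiv ≪≫ₗ
    LinearEquiv.prodCongr e e' ≪≫ₗ (TensorProduct.prodRight R R C P Q).symm⟩⟩

lemma projMod_enough (M : ModuleCat.{u} R) :
    ∃ (N : ModuleCat.{u} R) (f : N ⟶ M), projMod R N ∧ Epi f :=
  ⟨_, Projective.π M, (IsProjective.iff_projective _).2 (Projective.projective_over M),
    inferInstance⟩

lemma projective_of_projCx {X : Ch R} (hX : projCx R X) : Projective X := by
  obtain ⟨M, hM, ⟨e⟩⟩ := exists_iso_disk hX fun M N (_ : Module.Projective R M) _ =>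
    noExt_of_projective M N 0
  have := projective_disk fun i => (IsProjective.iff_projective _).1 (hM i)
  exact Projective.of_iso e.symm this

variable {C : ModuleCat.{u} R}

lemma IsSemidualizing.isAdmissible (hC : IsSemidualizing C) :
    IsAdmissible.{u} (projCx R) (cProjCx C) (cFlatCx C) where
  projective _ := projective_of_projCx
  enough := exists_epi_of_tilde projMod_enough
  le _ := tilde_mono fun _ => cFlatMod_of_cProjMod
  zero _ := tilde_of_isZero fun _ => cProjMod_of_isZero C
  biprod _ _ := tilde_biprod (fun _ _ hM hN => hC.noExt hM (cFlatMod_of_cProjMod hN) 0)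
    fun _ _ => cProjMod_biprod
  ext X hX H hH n := by
    obtain ⟨M, hM, ⟨e⟩⟩ := exists_iso_disk hX
      fun _ _ hM hN => hC.noExt hM (cFlatMod_of_cProjMod hN) 0
    exact subsingleton_ext_of_iso e.symm
      (subsingleton_ext_disk_of_cycles hH.1 (fun i j => hC.noExt (hM i) (hH.2 j)) n)

/-- Sums of disks on `dualTensorMod` form the coresolving class; it contains the projective
complexes because `R` is `Hom(C, C)`. -/
lemma IsSemidualizing.totalProj_of_projCx (hC : IsSemidualizing C) {X : Ch R} (hX : projCx R X) :
    totalProj (projCx R) (cProjCx C) (cFlatCx C) X := by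
  obtain ⟨M, hM, he⟩ := exists_iso_disk hX fun M N (_ : Module.Projective R M) _ =>
    noExt_of_projective M N 0
  refine hC.isAdmissible.totalProj_of_coresolving (W := fun X => ∃ M : ℤ → ModuleCat.{u} R,
    (∀ i, dualTensorMod C (M i)) ∧ Nonempty (X ≅ disk M)) ?_ ?_
    ⟨M, fun i => have : Module.Projective R (M i) := hM i; hC.dualTensorMod_of_projective _, he⟩
  · rintro X ⟨M, hM, ⟨e⟩⟩ H hH n
    exact subsingleton_ext_of_iso e.symm
      (subsingleton_ext_disk_of_cycles hH.1 (fun i j => noExt_of_dualTensorMod (hM i) (hH.2 j)) n)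
  · rintro X ⟨M, hM, ⟨e⟩⟩
    choose N L f g hfg hN hL using fun i => hC.exists_ses_of_dualTensorMod (hM i)
    exact ⟨_, _, _, _, tilde_disk hN, (ses_diskMap hfg).congr_left e, L, hL, ⟨Iso.refl _⟩⟩

end Classes

end DCProj

theorem theorem3p3 {R : Type u} [CommRing R] (C : ModuleCat.{u} R) (hC : DCProj.IsSemidualizing C)
    (X : DCProj.Ch R) (n : ℕ) :
    List.TFAE [
      DCProj.dcPd C X ≤ n,
      DCProj.dcPd C X < ⊤ ∧ ∀ m : ℕ, n < m → ∀ H : DCProj.Ch R, DCProj.fcPd C H < ⊤ →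
        Subsingleton (Abelian.Ext.{u} X H m),
      DCProj.dcPd C X < ⊤ ∧ ∀ m : ℕ, n < m → ∀ H : DCProj.Ch R, DCProj.cFlatCx C H →
        Subsingleton (Abelian.Ext.{u} X H m),
      ∀ E : DCProj.ExactResolution X, (∀ i : ℕ, DCProj.dcProjCx C (E.G.X i)) →
        DCProj.dcProjCx C (E.kernelObj n),
      ∀ t : ℕ, t ≤ n → ∃ E : DCProj.ExactResolution X,
        (∀ i : ℕ, i < t → DCProj.projCx R (E.G.X i)) ∧
        DCProj.dcProjCx C (E.G.X t) ∧
        (∀ i : ℕ, t < i → i ≤ n → DCProj.cProjCx C (E.G.X i)) ∧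
        ∀ i : ℕ, n < i → Limits.IsZero (E.G.X i)] :=
  have : (DCProj.cFlatCx C).IsClosedUnderIsomorphisms :=
    inferInstanceAs (DCProj.tilde (DCProj.cFlatMod C)).IsClosedUnderIsomorphisms
  -- `dcProjCx C` unfolds to `totalProj` of the three classes, so the abstract equivalence applies
  -- as it stands.
  hC.isAdmissible.tfae (fun _ => hC.totalProj_of_projCx) X n
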